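/- **Setting.** Let $b\ge 2$, $s\ge1$, $d\ge1$, $t\ge 0$ be integers and $\mathbb Z_b=\{0,\dots,b-1\}$. *Splits.* A $b$-fold split of a set $\mathcal X\subset\mathbb R^d$ of finite positive volume is a family of Borel sets $\mathcal X_a$, $a\in\mathbb Z_b$, with $\mathcal X=\bigcup_a\mathcal X_a$, $\mathrm{vol}(\mathcal X_a)=\mathrm{vol}(\mathcal X)/b$, and $\mathrm{vol}(\mathcal X_a\cap\mathcal X_{a'})=0$ for $a\ne a'$. A recursive split consists of $\mathcal X$ together with one $b$-fold split of each of its cells; $\mathcal X_{a_1,\dots,a_k}$ denotes the level-$k$ cells. Sets $S_k$ converge nicely to $x$ if there are $\alpha<\infty$ and cubes $C_k\ni x$ with $S_k\subseteq C_k$, $0<\mathrm{vol}(C_k)\le\alpha\,\mathrm{vol}(S_k)$, and $\mathrm{diam}(S_k)\to0$. The recursive split is convergent if for every sequence $a_1,a_2,\dots$ the cells $\mathcal X_{a_1,\dots,a_K}$ converge nicely to a point as $K\to\infty$; the associated transformation $\phi$ of $[0,1)$ sends $x=0.x_1x_2\dots$ (base $b$, expansion not ending in digits $b-1$) to that point for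 the digits of $x$. The split satisfies the sphericity condition if $\mathrm{diam}(\mathcal X_{a_1,\dots,a_k})\le C b^{-k/d}$ for all cells and some $C<\infty$. *Nets.* For $m\ge t$ and $n=b^m$, points $a_1,\dots,a_n\in[0,1]^s$ form a $(t,m,s)$-net in base $b$ if every box $\prod_j[c_jb^{-k_j},(c_j+1)b^{-k_j})$ with integers $k_j\ge0$, $0\le c_j<b^{k_j}$ and volume $b^{t-m}$ contains exactly $b^t$ of them (they then lie in $[0,1)^s$). The randomized net $u_1,\dots,u_n$ is its nested uniform scramble: independent uniform random permutations $\pi_{j,w}$ of $\mathbb Z_b$ are given for each coordinate $j$ and each finite digit string $w$, and the digits $a_{ij1},a_{ij2},\dots$ of $a_{ij}$ are replaced by $\pi_{j,(a_{ij1},\dots,a_{ijk})}(a_{ij,k+1})$, $k\ge0$, with the same permutations for all $i$. For $\emptyset\ne u\subseteq\{1,\dots,s\}$ and integers $\kappa=(k_j)_{j\in u}$, $k_j\ge0$, the gain coefficient is $$\Gamma_{u,\kappa}=\frac1n\sum_{i,i'=1}^n\prod_{j\in u}\frac{b\,1\{\lfloor b^{k_j+1}a_{ij}\rfloor=\lfloor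 b^{k_j+1}a_{i'j}\rfloor\}-1\{\lfloor b^{k_j}a_{ij}\rfloor=\lfloor b^{k_j}a_{i'j}\rfloor\}}{b-1}.$$ *Regions and smoothness.* Let $N=ds$. A closed set $\mathcal X\subseteq\mathbb R^{N}$ with non-empty interior is Sobol' extensible if for some $c\in\mathcal X$ the box spanned by $c$ and $z$ lies in $\mathcal X$ for every $z\in\mathcal X$. A function $f$ is smooth on $\mathcal X$ if for every $v\subseteq\{1,\dots,N\}$ the mixed partial derivative $\partial^vf$ (once in each variable of $v$, taken within $\mathcal X$) exists and is continuous on $\mathcal X$. A function $f$ is in $C^{N}(\mathcal X)$, $\mathcal X$ closed, in the sense of Whitney if there are functions $f_k$ on $\mathcal X$ for multi-indices $|k|\le N$, with $f_0=f$, such that for each $k$ $$f_k(y)=\sum_{|l|\le N-|k|}\frac{f_{k+l}(x)}{l!}(y-x)^l+o(|y-x|^{N-|k|})$$ for $x,y\in\mathcal X$, locally uniformly (at each $x_0\in\mathcal X$ as $x,y\to x_0$); this holds in particular if $f$ is $C^{N}$ on a neighbourhood of $\mathcal X$. **Theorem.** For $j=1,\dots,s$ let $\mathcal X^{(j)}\subset\mathbb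 R^d$ be bounded with $\mathrm{vol}(\mathcal X^{(j)})=1$, with a convergent recursive split in base $b$ that satisfies the sphericity condition, and let $\phi_j$ be its transformation. Put $\mathcal X^{1:s}=\prod_j\mathcal X^{(j)}\subset\mathbb R^{ds}$. Let $f$ be a real function on $\mathcal X^{1:s}$ such that either * $\mathcal X^{1:s}$ is Sobol' extensible and $f$ is smooth on it, or * each $\mathcal X^{(j)}$ is closed with non-empty interior and a boundary of measure zero, and $f\in C^{ds}(\mathcal X^{1:s})$ in the sense of Whitney. For a $(t,m,s)$-net in base $b$ with nested uniform scramble $u_1,\dots,u_n$, $n=b^m$, let $x_i=(\phi_1(u_{i1}),\dots,\phi_s(u_{is}))$ and $\hat\mu=\frac1n\sum_{i=1}^nf(x_i)$. Then $\hat\mu$ is square integrable, and if all gain coefficients satisfy $\Gamma_{u,\kappa}\le G<\infty$, then as $n=b^m\to\infty$ with $t$ fixed, $$\mathrm{Var}(\hat\mu)=O\!\left(\frac{(\log n)^{s-1}}{n^{1+2/d}}\right).$$ More precisely, for given $b,s,d,t,G$, splits and $f$ there is a constant $K$ such that $\mathrm{Var}(\hat\mu)\le K(\log n)^{s-1}/n^{1+2/d}$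 for all $m\ge1$ with $m\ge t$ and all such nets whose gain coefficients are at most $G$. -/

import Mathlib

open MeasureTheory ProbabilityTheory Filter Topology

noncomputable section

namespace GeomNet

/-! ### Digital nets, nested uniform scrambling, gain coefficients -/

/-- `a` is a `(t,m,s)`-net in base `b`: every `b`-adic box
`∏ j, [c j / b ^ k j, (c j + 1) / b ^ k j)` of volume `b ^ (t - m)` contains precisely `b ^ t`
of the `b ^ m` points. -/
def IsNet (b t m : ℕ) {s : ℕ} (a : Fin (b ^ m) → Fin s → ℝ) : Prop :=
  t ≤ m ∧ (∀ i j, a i j ∈ Set.Icc (0 : ℝ) 1) ∧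
    ∀ k c : Fin s → ℕ, (∀ j, c j < b ^ k j) → ∑ j, k j = m - t →
      Set.ncard {i | ∀ j, a i j ∈
        Set.Ico ((c j : ℝ) / (b : ℝ) ^ k j) (((c j : ℝ) + 1) / (b : ℝ) ^ k j)} = b ^ t

/-- The first `K` base `b` digits of `x ∈ [0,1)`. `Real.digits` is the expansion by floors,
that is, the one that does not end in a tail of digits `b - 1`. -/
def digitPrefix (b : ℕ) [NeZero b] (x : ℝ) (K : ℕ) : List (Fin b) :=
  List.ofFn fun i : Fin K => Real.digits x b i

/-- One-dimensional nested scramble of `a` by permutations `π` indexed by digit prefixes: the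
digit `a_{k+1}` becomes `π_{a_1 ⋯ a_k} (a_{k+1})`. -/
def nestedScramble (b : ℕ) [NeZero b] (π : List (Fin b) → Equiv.Perm (Fin b)) (a : ℝ) : ℝ :=
  Real.ofDigits fun k => π (digitPrefix b a k) (Real.digits a b k)

instance permMeasurableSpace (b : ℕ) : MeasurableSpace (Equiv.Perm (Fin b)) := ⊤

/-- Independent uniform random permutations of the digits, one for each coordinate `j` and each
finite digit prefix. -/
def IsUniformPermFamily (b s : ℕ) {Ω : Type*} [MeasurableSpace Ω] (P : Measure Ω)
    (π : Fin s × List (Fin b) → Ω → Equiv.Perm (Fin b)) : Prop :=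
  (∀ q, Measurable (π q)) ∧ iIndepFun π P ∧
    ∀ q σ, P {ω | π q ω = σ} = ((Nat.factorial b : ENNReal))⁻¹

/-- The factor `Υ` of the gain coefficients, for the values `x`, `y` of one coordinate of two
points. -/
def upsilon (b k : ℕ) (x y : ℝ) : ℝ :=
  (1 / ((b : ℝ) - 1)) *
    ((b : ℝ) * (if ⌊(b : ℝ) ^ (k + 1) * x⌋ = ⌊(b : ℝ) ^ (k + 1) * y⌋ then 1 else 0)
      - (if ⌊(b : ℝ) ^ k * x⌋ = ⌊(b : ℝ) ^ k * y⌋ then 1 else 0))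

/-- The gain coefficient `Γ_{u,κ}` of the points `a` (only the entries `κ j` with `j ∈ u`
matter). -/
def gain (b : ℕ) {n s : ℕ} (a : Fin n → Fin s → ℝ) (u : Finset (Fin s)) (κ : Fin s → ℕ) : ℝ :=
  (1 / (n : ℝ)) * ∑ i, ∑ i', ∏ j ∈ u, upsilon b (κ j) (a i j) (a i' j)

/-! ### Recursive splits and their transformations -/

/-- `parts` is a `b`-fold split of the set `X` of finite positive volume. -/
def IsSplit {d : ℕ} (b : ℕ) (X : Set (EuclideanSpace ℝ (Fin d)))
    (parts : Fin b → Set (EuclideanSpace ℝ (Fin d))) : Prop :=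
  0 < volume X ∧ volume X < ⊤ ∧ (∀ a, MeasurableSet (parts a)) ∧ X = ⋃ a, parts a ∧
    (∀ a, volume (parts a) = volume X / (b : ENNReal)) ∧
    ∀ a a', a ≠ a' → volume (parts a ∩ parts a') = 0

/-- The cells `cell [a₁, …, a_k]` form a recursive `b`-fold split of `X`. -/
def IsRecursiveSplit {d : ℕ} (b : ℕ) (X : Set (EuclideanSpace ℝ (Fin d)))
    (cell : List (Fin b) → Set (EuclideanSpace ℝ (Fin d))) : Prop :=
  cell [] = X ∧ ∀ w, IsSplit b (cell w) fun a => cell (w ++ [a])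

/-- The axis-parallel closed cube with lowest corner `z` and side `r`. -/
def cube {d : ℕ} (z : EuclideanSpace ℝ (Fin d)) (r : ℝ) : Set (EuclideanSpace ℝ (Fin d)) :=
  {y | ∀ i, y i ∈ Set.Icc (z i) (z i + r)}

/-- The sequence of sets `S` converges nicely to the point `x`. -/
def ConvergesNicely {d : ℕ} (S : ℕ → Set (EuclideanSpace ℝ (Fin d)))
    (x : EuclideanSpace ℝ (Fin d)) : Prop :=
  (∃ α : NNReal, ∃ z : ℕ → EuclideanSpace ℝ (Fin d), ∃ r : ℕ → ℝ, ∀ k,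
    x ∈ cube (z k) (r k) ∧ S k ⊆ cube (z k) (r k) ∧
      0 < volume (cube (z k) (r k)) ∧ volume (cube (z k) (r k)) ≤ α * volume (S k)) ∧
  Tendsto (fun k => Metric.ediam (S k)) atTop (𝓝 0)

/-- Along every infinite digit sequence the cells converge nicely to a point. -/
def IsConvergentSplit {d b : ℕ} (cell : List (Fin b) → Set (EuclideanSpace ℝ (Fin d))) : Prop :=
  ∀ a : ℕ → Fin b, ∃ x, ConvergesNicely (fun K => cell (List.ofFn fun i : Fin K => a i)) x

/-- The sphericity condition: cells at level `k` have diameter at most `C b ^ (-k/d)`. -/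
def SatisfiesSphericity {d b : ℕ} (cell : List (Fin b) → Set (EuclideanSpace ℝ (Fin d))) : Prop :=
  ∃ C : ℝ, ∀ w, Metric.ediam (cell w) ≤
    ENNReal.ofReal (C * (b : ℝ) ^ (-((w.length : ℝ) / (d : ℝ))))

/-- The transformation of `[0,1)` defined by a convergent recursive split: `x` is sent to the
point to which the cells along the base `b` digits of `x` converge nicely. -/
def splitTransform {d b : ℕ} [NeZero b] (cell : List (Fin b) → Set (EuclideanSpace ℝ (Fin d)))
    (x : ℝ) : EuclideanSpace ℝ (Fin d) :=
  Classical.epsilon fun p => ConvergesNicely (fun K => cell (digitPrefix b x K)) p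

/-! ### Products, regions and smoothness

The product of `s` regions of `ℝ^d` is a subset of `ℝ^(ds)`, with coordinates indexed by
`Fin s × Fin d`. -/

/-- The point of `ℝ^(ds)` obtained by concatenating `s` points of `ℝ^d`. -/
def concat {s d : ℕ} (x : Fin s → EuclideanSpace ℝ (Fin d)) : Fin s × Fin d → ℝ :=
  fun q => x q.1 q.2

/-- The product of the sets `X j`, as a subset of `ℝ^(ds)`. -/
def prodSet {s d : ℕ} (X : Fin s → Set (EuclideanSpace ℝ (Fin d))) : Set (Fin s × Fin d → ℝ) :=
  concat '' Set.univ.pi X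

/-- Sobol' extensible sets; `Set.uIcc c z` is the rectangular hull of `c` and `z`. -/
def IsSobolExtensible {ι : Type*} (X : Set (ι → ℝ)) : Prop :=
  IsClosed X ∧ (interior X).Nonempty ∧ ∃ c ∈ X, ∀ z ∈ X, Set.uIcc c z ⊆ X

/-- `f` is smooth on `X`: the mixed partial derivatives `∂^v f = g v`, at most once in each
variable, exist and are continuous on `X`. Derivatives are taken within `X` (so they are one-sided
where needed), and `g (insert i v)` is the partial derivative of `g v` in the variable `i ∉ v`. -/
def IsSmoothOn {ι : Type*} [DecidableEq ι] (f : (ι → ℝ) → ℝ) (X : Set (ι → ℝ)) : Prop :=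
  ∃ g : Finset ι → (ι → ℝ) → ℝ, (∀ x ∈ X, g ∅ x = f x) ∧ (∀ v, ContinuousOn (g v) X) ∧
    ∀ v, ∀ i ∉ v, ∀ x ∈ X,
      HasDerivWithinAt (fun r => g v (Function.update x i r)) (g (insert i v) x)
        {r | Function.update x i r ∈ X} (x i)

/-- `f` belongs to Whitney's class `C^N(X)`: there are functions `D k` on `X` for the multi-indices
`k` of order at most `N`, with `D 0 = f`, such that the Taylor expansion of order `N - |k|` of each
`D k` has a remainder that is `o(|y - x|^(N - |k|))` locally uniformly for `x, y ∈ X`. (At interior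
points of `X`, `D k` is the partial derivative of `f`. The distance here is the maximum distance,
which is equivalent to the Euclidean one.) -/
def IsWhitneyC {ι : Type*} [Fintype ι] [DecidableEq ι] (N : ℕ) (f : (ι → ℝ) → ℝ)
    (X : Set (ι → ℝ)) : Prop :=
  ∃ D : (ι → ℕ) → (ι → ℝ) → ℝ, (∀ x ∈ X, D 0 x = f x) ∧
    ∀ k : ι → ℕ, ∑ i, k i ≤ N → ∀ x₀ ∈ X, ∀ ε > 0, ∃ δ > 0, ∀ x ∈ X, ∀ y ∈ X,
      dist x x₀ < δ → dist y x₀ < δ →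
        |D k y - ∑ r ∈ Finset.range (N - ∑ i, k i + 1), ∑ l ∈ Finset.univ.piAntidiag r,
            D (k + l) x / (∏ i, (Nat.factorial (l i) : ℝ)) * ∏ i, (y i - x i) ^ l i|
          ≤ ε * dist y x ^ (N - ∑ i, k i)

/-! ### The estimator -/

/-- The equal-weight estimate `μ̂ = (1/n) ∑ i, f (φ (u i))`, where `u i` is the nested scramble of
`a i` by the permutations `π` and `φ` acts componentwise by the transformations of the splits. -/
def muHat {b s d n : ℕ} [NeZero b] {Ω : Type*}
    (cell : Fin s → List (Fin b) → Set (EuclideanSpace ℝ (Fin d)))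
    (f : (Fin s × Fin d → ℝ) → ℝ) (a : Fin n → Fin s → ℝ)
    (π : Fin s × List (Fin b) → Ω → Equiv.Perm (Fin b)) (ω : Ω) : ℝ :=
  (1 / (n : ℝ)) * ∑ i, f (concat fun j =>
    splitTransform (cell j) (nestedScramble b (fun w => π (j, w) ω) (a i j)))

end GeomNet

end

/-!
The estimate is a function of the scrambled digits, and its variance is computed by a Haar
(nested ANOVA) decomposition in each of the `s` coordinates.

*The integrand in terms of digits.* Cells at level `k` of a split have diameter
`O(b ^ (-k / d))`, and the transformations send digit sequences to points in the closures of the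
cells. So a bound of the mixed difference of `f` over the blocks `j ∈ w` by a constant times
`∏ j ∈ w, |x j - x' j|` turns into a bound by a constant times `∏ j ∈ w, b ^ (-k j / d)` for
arguments that share `k j` digits in coordinate `j` (`exists_rdiff_digitIntegrand_bound`). Bounding
the mixed differences is where smoothness enters. For a jet in Whitney's sense no extension of `f`
is needed: Taylor expansion in the block with the smallest distance reduces the order of the
difference, and the powers of that distance pay for lost smoothness
(`IsJet.exists_rdiff_bound`). On a Sobol' extensible set, `f` is recovered from the mixed partial
derivatives along the segments to the anchor; continuing the derivatives by zero gives an
extension whose mixed differences are integrals (`exists_rdiff_anchoredExt_bound`).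

*The variance.* The scrambles of two points are independent over the coordinates, and the joint
law of their digits in one coordinate is diagonal in the Haar kernels, with eigenvalues that are
the factors of the gain coefficients (`prod_digitProb`). The second moment of a centred
function of finitely many digits is therefore the sum over `κ ≠ 0` of a gain coefficient times a
variance component, divided by `n` (`IsUniformPermFamily.integral_sq_eq`). The component of order
`κ` is `O(b ^ (-2 |κ| / d))`, because the Haar kernels only see mixed differences
(`haarForm_mem_Icc`), and the gain coefficient vanishes for `|κ| ≤ m - t`, because the net is
equidistributed over the boxes of volume `b ^ (-|κ|)` (`IsNet.sum_prod_digitGain_eq_zero`). Here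
`κ j = 0` stands for `j ∉ u`, so that `|κ|` is `|u|` plus the order used in the definition of
`gain`.
The remaining tail of a multiple geometric series is `O(m ^ (s - 1) b ^ (-2 m / d))`
(`exists_sum_pow_le`), which is the rate. Functions of all digits are uniform limits of functions
of finitely many.
-/

namespace GeomNet

/-! ### Rectangular differences over blocks of coordinates -/

/-- The point that takes its coordinates in the blocks `j ∈ V` from `x'` and the others from `x`.
The map `p` sends a coordinate to the block that contains it. -/
def mix {ι κ A : Type*} [DecidableEq κ] (p : ι → κ) (V : Finset κ) (x x' : ι → A) : ι → A :=
  fun q => if p q ∈ V then x' q else x q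

/-- The alternating sum of `f` over the vertices of the rectangle spanned by `x` and `x'`, where
the blocks in `w` vary and the others stay at `x`. -/
def rdiff {ι κ A : Type*} [DecidableEq κ] (p : ι → κ) (w : Finset κ) (f : (ι → A) → ℝ)
    (x x' : ι → A) : ℝ :=
  ∑ V ∈ w.powerset, (-1) ^ V.card * f (mix p V x x')

section rdiff

variable {ι κ A : Type*} [DecidableEq κ] (p : ι → κ)

lemma mix_empty (x x' : ι → A) : mix p ∅ x x' = x := by
  ext q; simp [mix]

lemma mix_mix (U V : Finset κ) (x x' : ι → A) : mix p V (mix p U x x') x' = mix p (V ∪ U) x x' := by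
  ext q; simp only [mix, Finset.mem_union]; split_ifs <;> tauto

lemma rdiff_empty (f : (ι → A) → ℝ) (x x' : ι → A) : rdiff p ∅ f x x' = f x := by
  simp [rdiff, mix_empty]

lemma rdiff_insert {j : κ} {w : Finset κ} (hj : j ∉ w) (f : (ι → A) → ℝ) (x x' : ι → A) :
    rdiff p (insert j w) f x x' = rdiff p w f x x' - rdiff p w f (mix p {j} x x') x' := by
  rw [rdiff, Finset.sum_powerset_insert hj, rdiff, rdiff, sub_eq_add_neg, ← Finset.sum_neg_distrib]
  congr 1
  refine Finset.sum_congr rfl fun V hV => ?_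
  have hjV : j ∉ V := fun h => hj (Finset.mem_powerset.1 hV h)
  rw [Finset.card_insert_of_notMem hjV, mix_mix, Finset.union_comm, ← Finset.insert_eq]
  ring

/-- Differencing in further blocks costs at most a factor `2` for each of them. -/
lemma abs_rdiff_union_le {w t : Finset κ} {f : (ι → A) → ℝ} {x' : ι → A} {M : ℝ}
    (hd : Disjoint t w) (x : ι → A) (h : ∀ V, |rdiff p w f (mix p V x x') x'| ≤ M) :
    |rdiff p (t ∪ w) f x x'| ≤ 2 ^ t.card * M := by
  induction t using Finset.induction_on generalizing x with
  | empty => simpa [mix_empty] using h ∅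
  | insert j t hj ih =>
    rw [Finset.disjoint_insert_left] at hd
    have hj' : j ∉ t ∪ w := by simp [hj, hd.1]
    rw [Finset.insert_union, rdiff_insert p hj', Finset.card_insert_of_notMem hj]
    have h1 := ih hd.2 x h
    have h2 := ih hd.2 (mix p {j} x x') fun V => by rw [mix_mix]; exact h _
    refine (abs_sub _ _).trans ?_
    rw [pow_succ]
    linarith

lemma rdiff_congr {w : Finset κ} {f f' : (ι → A) → ℝ}
    {x x' : ι → A} (h : ∀ V ⊆ w, f (mix p V x x') = f' (mix p V x x')) :
    rdiff p w f x x' = rdiff p w f' x x' :=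
  Finset.sum_congr rfl fun V hV => by rw [h V (Finset.mem_powerset.1 hV)]

lemma rdiff_add (w : Finset κ) (f f' : (ι → A) → ℝ)
    (x x' : ι → A) :
    rdiff p w (fun z => f z + f' z) x x' = rdiff p w f x x' + rdiff p w f' x x' := by
  simp only [rdiff, mul_add, Finset.sum_add_distrib]

lemma abs_mix_le {R : ℝ} {x x' : ι → ℝ} (hx : ∀ q, |x q| ≤ R)
    (hx' : ∀ q, |x' q| ≤ R) (V : Finset κ) (q : ι) : |mix p V x x' q| ≤ R := by
  simp only [mix]; split_ifs
  · exact hx' q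
  · exact hx q

end rdiff

/-! ### Rectangular differences of Whitney jets -/

lemma one_le_abs_prod_factorial {ι : Type*} [Fintype ι] (l : ι → ℕ) :
    1 ≤ |∏ i, (Nat.factorial (l i) : ℝ)| := by
  rw [← Nat.cast_prod, Nat.abs_cast]
  exact_mod_cast Finset.prod_pos fun i _ => Nat.factorial_pos (l i)

section whitney

variable {ι κ : Type*} [Fintype ι] [DecidableEq ι]

/-- The Taylor polynomial about `x`, of order `N - |k|`, of the entry `D k` of a jet. -/
noncomputable def taylorJet (D : (ι → ℕ) → (ι → ℝ) → ℝ) (N : ℕ) (k : ι → ℕ) (x y : ι → ℝ) : ℝ :=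
  ∑ r ∈ Finset.range (N - ∑ i, k i + 1), ∑ l ∈ Finset.univ.piAntidiag r,
    D (k + l) x / (∏ i, (Nat.factorial (l i) : ℝ)) * ∏ i, (y i - x i) ^ l i

/-- The Taylor condition on a jet in Whitney's sense. -/
def IsJet (D : (ι → ℕ) → (ι → ℝ) → ℝ) (N : ℕ) (X : Set (ι → ℝ)) : Prop :=
  ∀ k : ι → ℕ, ∑ i, k i ≤ N → ∀ x₀ ∈ X, ∀ ε > 0, ∃ δ > 0, ∀ x ∈ X, ∀ y ∈ X,
    dist x x₀ < δ → dist y x₀ < δ →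
      |D k y - taylorJet D N k x y| ≤ ε * dist y x ^ (N - ∑ i, k i)

variable {D : (ι → ℕ) → (ι → ℝ) → ℝ} {N : ℕ} {X : Set (ι → ℝ)}

lemma IsJet.exists_bound (hD : IsJet D N X) (hX : IsCompact X) {k : ι → ℕ} (hk : ∑ i, k i ≤ N) :
    ∃ M : ℝ, 0 ≤ M ∧ ∀ x ∈ X, |D k x| ≤ M := by
  have key : ∃ M : ℝ, ∀ x ∈ X, |D k x| ≤ M := by
    refine hX.induction_on (p := fun S => ∃ M : ℝ, ∀ x ∈ S, |D k x| ≤ M) ⟨0, by simp⟩ ?_ ?_ ?_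
    · rintro S T hST ⟨M, hM⟩
      exact ⟨M, fun x hx => hM x (hST hx)⟩
    · rintro S T ⟨M, hM⟩ ⟨M', hM'⟩
      exact ⟨max M M', fun x hx => hx.elim (fun h => (hM x h).trans (le_max_left _ _))
        fun h => (hM' x h).trans (le_max_right _ _)⟩
    · intro x₀ hx₀
      obtain ⟨δ, hδ, h⟩ := hD k hk x₀ hx₀ 1 one_pos
      have hc : Continuous fun y : ι → ℝ =>
          |taylorJet D N k x₀ y| + dist y x₀ ^ (N - ∑ i, k i) := by
        unfold taylorJet; fun_prop
      obtain ⟨M, hM⟩ := hX.exists_bound_of_continuousOn hc.continuousOn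
      refine ⟨X ∩ Metric.ball x₀ δ, inter_mem_nhdsWithin _ (Metric.ball_mem_nhds _ hδ), M, ?_⟩
      rintro y ⟨hy, hyδ⟩
      have h1 := h x₀ hx₀ y hy (by simpa using hδ) hyδ
      have h2 := (Real.le_norm_self _).trans (hM y hy)
      rw [one_mul] at h1
      have h3 := abs_sub_abs_le_abs_sub (D k y) (taylorJet D N k x₀ y)
      linarith
  obtain ⟨M, hM⟩ := key
  exact ⟨max M 0, le_max_right _ _, fun x hx => (hM x hx).trans (le_max_left _ _)⟩

/-- On a compact set the remainder of a jet is `O(|y - x| ^ (N - |k|))` uniformly. -/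
lemma IsJet.exists_remainder_bound (hD : IsJet D N X) (hX : IsCompact X) {k : ι → ℕ}
    (hk : ∑ i, k i ≤ N) :
    ∃ C : ℝ, 0 ≤ C ∧ ∀ x ∈ X, ∀ y ∈ X,
      |D k y - taylorJet D N k x y| ≤ C * dist y x ^ (N - ∑ i, k i) := by
  choose! δ hδ h using fun x₀ hx₀ => hD k hk x₀ hx₀ 1 one_pos
  obtain ⟨ρ, hρ, hcov⟩ := lebesgue_number_lemma_of_metric
    (c := fun x₀ : X => Metric.ball x₀.1 (δ x₀))
    hX (fun _ => Metric.isOpen_ball)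
    (fun x hx => Set.mem_iUnion.2 ⟨⟨x, hx⟩, Metric.mem_ball_self (hδ x hx)⟩)
  obtain ⟨M, hM0, hM⟩ := hD.exists_bound hX hk
  have hT : ∃ M' : ℝ, 0 ≤ M' ∧ ∀ x ∈ X, ∀ y ∈ X, |taylorJet D N k x y| ≤ M' := by
    have hMl : ∀ l : ι → ℕ, ∃ M : ℝ, 0 ≤ M ∧
        (∑ i, (k + l) i ≤ N → ∀ x ∈ X, |D (k + l) x| ≤ M) := fun l => by
      by_cases hl : ∑ i, (k + l) i ≤ N
      · obtain ⟨M, h0, h⟩ := hD.exists_bound hX hl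
        exact ⟨M, h0, fun _ => h⟩
      · exact ⟨0, le_rfl, fun h => absurd h hl⟩
    choose B hB0 hB using hMl
    obtain ⟨R, hR⟩ := hX.isBounded.exists_norm_le
    have hR0 : 0 ≤ 2 * |R| := by positivity
    refine ⟨∑ r ∈ Finset.range (N - ∑ i, k i + 1), ∑ l ∈ Finset.univ.piAntidiag r,
      B l * ∏ i, (2 * |R|) ^ l i, ?_, fun x hx y hy => ?_⟩
    · exact Finset.sum_nonneg fun r _ => Finset.sum_nonneg fun l _ => mul_nonneg (hB0 l)
        (Finset.prod_nonneg fun i _ => by positivity)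
    · refine (Finset.abs_sum_le_sum_abs _ _).trans (Finset.sum_le_sum fun r hr => ?_)
      refine (Finset.abs_sum_le_sum_abs _ _).trans (Finset.sum_le_sum fun l hl => ?_)
      rw [abs_mul, Finset.abs_prod]
      have hl' : ∑ i, l i = r := (Finset.mem_piAntidiag.1 hl).1
      have hr' := Finset.mem_range.1 hr
      refine mul_le_mul ?_ ?_ (Finset.prod_nonneg fun i _ => abs_nonneg _) (hB0 l)
      · rw [abs_div]
        refine (div_le_self (abs_nonneg _) ?_).trans (hB l ?_ x hx)
        · exact one_le_abs_prod_factorial l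
        · simp only [Pi.add_apply, Finset.sum_add_distrib, hl']; omega
      · refine Finset.prod_le_prod (fun i _ => abs_nonneg _) fun i _ => ?_
        rw [abs_pow]
        refine pow_le_pow_left₀ (abs_nonneg _) ?_ _
        have h1 := (norm_le_pi_norm x i).trans ((hR x hx).trans (le_abs_self R))
        have h2 := (norm_le_pi_norm y i).trans ((hR y hy).trans (le_abs_self R))
        rw [Real.norm_eq_abs] at h1 h2
        exact (abs_sub _ _).trans (by linarith)
  obtain ⟨M', hM'0, hM'⟩ := hT
  set n := N - ∑ i, k i
  refine ⟨1 + (M + M') / ρ ^ n, by positivity, fun x hx y hy => ?_⟩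
  have hd : 0 ≤ dist y x ^ n := by positivity
  rcases lt_or_ge (dist y x) ρ with hlt | hge
  · obtain ⟨x₀, hx₀⟩ := hcov x hx
    have h1 := h x₀.1 x₀.2 x hx y hy (hx₀ (Metric.mem_ball_self hρ)) (hx₀ hlt)
    rw [one_mul] at h1
    have : 0 ≤ (M + M') / ρ ^ n * dist y x ^ n := by positivity
    linarith
  · have h1 : |D k y - taylorJet D N k x y| ≤ M + M' :=
      (abs_sub _ _).trans (add_le_add (hM y hy) (hM' x hx y hy))
    have h2 : M + M' ≤ (M + M') / ρ ^ n * dist y x ^ n := by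
      rw [div_mul_eq_mul_div, le_div_iff₀ (by positivity)]
      exact mul_le_mul_of_nonneg_left (pow_le_pow_left₀ hρ.le hge n) (by positivity)
    linarith

/-- If `a` is a lower bound of the numbers `h i`, powers of `a` may be traded for missing factors
`h i`. -/
lemma pow_mul_prod_le {κ : Type*} [DecidableEq κ] {w w' : Finset κ} {h : κ → ℝ} {a H : ℝ}
    {r N : ℕ} (hw : w' ⊆ w) (hr : (w \ w').card ≤ r) (hrN : r ≤ N) (ha : 0 ≤ a) (haH : a ≤ H)
    (hH : 1 ≤ H) (hah : ∀ i ∈ w, a ≤ h i) :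
    a ^ r * ∏ i ∈ w', h i ≤ H ^ N * ∏ i ∈ w, h i := by
  have h0 : 0 ≤ ∏ i ∈ w', h i := Finset.prod_nonneg fun i hi => ha.trans (hah i (hw hi))
  have h1 : a ^ (w \ w').card ≤ ∏ i ∈ w \ w', h i := by
    rw [← Finset.prod_const]
    exact Finset.prod_le_prod (fun _ _ => ha) fun i hi => hah i (Finset.mem_sdiff.1 hi).1
  have h2 : a ^ (r - (w \ w').card) ≤ H ^ N :=
    (pow_le_pow_left₀ ha haH _).trans (pow_le_pow_right₀ hH (by omega))
  rw [← Finset.prod_sdiff hw, ← mul_assoc]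
  refine mul_le_mul_of_nonneg_right ?_ h0
  rw [show r = (r - (w \ w').card) + (w \ w').card by omega, pow_add]
  exact mul_le_mul h2 h1 (by positivity) (by positivity)

/-- The mixed difference of a jet over `n` blocks is at most a constant times the product of
the block distances. The proof expands the jet in the block `j` with the smallest distance `h j`:
a term of order `r` in that expansion carries `h j ^ r`, which pays for the block `j` and for
`r - 1` further blocks in which the entry of order `r` has too little smoothness to be
differenced. -/
lemma IsJet.exists_rdiff_bound [DecidableEq κ] (hD : IsJet D N X) (hX : IsCompact X) (p : ι → κ)
    (hmix : ∀ x ∈ X, ∀ x' ∈ X, ∀ V, mix p V x x' ∈ X) {H : ℝ} (hH : 1 ≤ H) (n : ℕ) (k : ι → ℕ)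
    (hk : ∑ i, k i + n ≤ N) :
    ∃ C : ℝ, 0 ≤ C ∧ ∀ w : Finset κ, w.card = n → ∀ x ∈ X, ∀ x' ∈ X, ∀ h : κ → ℝ,
      (∀ q, |x' q - x q| ≤ h (p q)) → (∀ j, 0 ≤ h j) → (∀ j, h j ≤ H) →
        |rdiff p w (D k) x x'| ≤ C * ∏ j ∈ w, h j := by
  induction n using Nat.strong_induction_on generalizing k with
  | _ n ih =>
  rcases Nat.eq_zero_or_pos n with rfl | hn
  · obtain ⟨M, hM0, hM⟩ := hD.exists_bound hX (k := k) (by omega)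
    refine ⟨M, hM0, fun w hw x hx x' hx' h _ _ _ => ?_⟩
    rw [Finset.card_eq_zero] at hw
    subst hw
    simpa [rdiff_empty] using hM x hx
  have ih' : ∀ (q : ℕ) (l : ι → ℕ), ∃ C : ℝ, 0 ≤ C ∧ (q < n → ∑ i, (k + l) i + q ≤ N →
      ∀ w : Finset κ, w.card = q → ∀ x ∈ X, ∀ x' ∈ X, ∀ h : κ → ℝ,
      (∀ q, |x' q - x q| ≤ h (p q)) → (∀ j, 0 ≤ h j) → (∀ j, h j ≤ H) →
        |rdiff p w (D (k + l)) x x'| ≤ C * ∏ j ∈ w, h j) := fun q l => by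
    by_cases hq : q < n ∧ ∑ i, (k + l) i + q ≤ N
    · obtain ⟨C, h0, h⟩ := ih q hq.1 (k + l) hq.2
      exact ⟨C, h0, fun _ _ => h⟩
    · exact ⟨0, le_rfl, fun h1 h2 => absurd ⟨h1, h2⟩ hq⟩
  choose B hB0 hB using ih'
  obtain ⟨R, hR0, hR⟩ := hD.exists_remainder_bound hX (k := k) (by omega)
  set m := N - ∑ i, k i with hm
  refine ⟨∑ r ∈ Finset.range m, ∑ l ∈ (Finset.univ : Finset ι).piAntidiag (r + 1),
    2 ^ n * B (n - (r + 1)) l * H ^ N + 2 ^ n * (R * H ^ N), ?_,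
    fun w hw x hx x' hx' h hh hh0 hhH => ?_⟩
  · have hH0 : 0 ≤ H := by linarith
    refine add_nonneg (Finset.sum_nonneg fun r _ => Finset.sum_nonneg fun l _ => ?_) (by positivity)
    have := hB0 (n - (r + 1)) l
    positivity
  obtain ⟨j, hjw, hjmin⟩ := Finset.exists_min_image w h (Finset.card_pos.1 (by omega))
  set w₀ := w.erase j with hw₀
  have hj₀ : j ∉ w₀ := Finset.notMem_erase j w
  have hins : insert j w₀ = w := Finset.insert_erase hjw
  have hw₀n : w₀.card + 1 = n := by rw [← hw, ← hins, Finset.card_insert_of_notMem hj₀]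
  have hP0 : 0 ≤ ∏ i ∈ w, h i := Finset.prod_nonneg fun i _ => hh0 i
  -- the increment of the point in block `j`
  set η : ι → ℝ := fun q => if p q = j then x' q - x q else 0 with hη
  have hηh : ∀ q, |η q| ≤ h j := fun q => by
    simp only [hη]
    split_ifs with hq
    · rw [← hq]; exact hh q
    · simpa using hh0 j
  have hdiff : ∀ V ∈ w₀.powerset, ∀ q,
      mix p V (mix p {j} x x') x' q - mix p V x x' q = η q := fun V hV q => by
    have hjV : j ∉ V := fun hh => hj₀ (Finset.mem_powerset.1 hV hh)
    simp only [mix, hη, Finset.mem_singleton]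
    split_ifs with h1 h2 <;> simp
    rw [h2] at h1; exact absurd h1 hjV
  set Rm : Finset κ → ℝ := fun V => D k (mix p V (mix p {j} x x') x')
    - taylorJet D N k (mix p V x x') (mix p V (mix p {j} x x') x') with hRm
  have hmj : mix p {j} x x' ∈ X := hmix x hx x' hx' _
  have hRmb : ∀ V ∈ w₀.powerset, |Rm V| ≤ R * h j ^ m := fun V hV => by
    refine (hR _ (hmix x hx x' hx' V) _ (hmix _ hmj x' hx' V)).trans ?_
    refine mul_le_mul_of_nonneg_left (pow_le_pow_left₀ dist_nonneg ?_ _) hR0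
    refine (dist_pi_le_iff (hh0 j)).2 fun q => ?_
    rw [Real.dist_eq, hdiff V hV q]
    exact hηh q
  have hexp : rdiff p w (D k) x x' =
      -(∑ r ∈ Finset.range m, ∑ l ∈ (Finset.univ : Finset ι).piAntidiag (r + 1),
        (∏ i, η i ^ l i) / (∏ i, (Nat.factorial (l i) : ℝ)) * rdiff p w₀ (D (k + l)) x x')
      - ∑ V ∈ w₀.powerset, (-1) ^ V.card * Rm V := by
    rw [← hins, rdiff_insert p hj₀]
    have h1 : ∀ V ∈ w₀.powerset, (-1 : ℝ) ^ V.card * D k (mix p V (mix p {j} x x') x') =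
        (-1) ^ V.card * D k (mix p V x x') +
        (∑ r ∈ Finset.range m, ∑ l ∈ (Finset.univ : Finset ι).piAntidiag (r + 1),
          (∏ i, η i ^ l i) / (∏ i, (Nat.factorial (l i) : ℝ)) *
            ((-1) ^ V.card * D (k + l) (mix p V x x'))) + (-1) ^ V.card * Rm V := by
      intro V hV
      have h2 : D k (mix p V (mix p {j} x x') x') = taylorJet D N k (mix p V x x')
        (mix p V (mix p {j} x x') x') + Rm V := by simp [hRm]
      rw [h2, taylorJet, ← hm, Finset.sum_range_succ']
      simp only [hdiff V hV, Finset.piAntidiag_zero, Finset.sum_singleton, add_zero, Pi.zero_apply,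
        pow_zero, Finset.prod_const_one, Nat.factorial_zero, Nat.cast_one, div_one, mul_one]
      rw [mul_add, mul_add, add_comm ((-1 : ℝ) ^ V.card * _) ((-1 : ℝ) ^ V.card * D k _),
        Finset.mul_sum]
      congr 2
      refine Finset.sum_congr rfl fun r _ => ?_
      rw [Finset.mul_sum]
      refine Finset.sum_congr rfl fun l _ => ?_
      ring
    have h3 : rdiff p w₀ (D k) (mix p {j} x x') x' = rdiff p w₀ (D k) x x' +
        (∑ r ∈ Finset.range m, ∑ l ∈ (Finset.univ : Finset ι).piAntidiag (r + 1),
          (∏ i, η i ^ l i) / (∏ i, (Nat.factorial (l i) : ℝ)) * rdiff p w₀ (D (k + l)) x x')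
        + ∑ V ∈ w₀.powerset, (-1) ^ V.card * Rm V := by
      rw [rdiff, Finset.sum_congr rfl h1, Finset.sum_add_distrib, Finset.sum_add_distrib,
        Finset.sum_comm]
      simp only [rdiff, Finset.mul_sum]
      congr 2
      refine Finset.sum_congr rfl fun r _ => ?_
      rw [Finset.sum_comm]
    rw [h3]; ring
  have hterm : ∀ r ∈ Finset.range m, ∀ l ∈ (Finset.univ : Finset ι).piAntidiag (r + 1),
      |(∏ i, η i ^ l i) / (∏ i, (Nat.factorial (l i) : ℝ)) * rdiff p w₀ (D (k + l)) x x'| ≤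
        2 ^ n * B (n - (r + 1)) l * H ^ N * ∏ i ∈ w, h i := by
    intro r hr l hl
    have hl' : ∑ i, l i = r + 1 := (Finset.mem_piAntidiag.1 hl).1
    have hr' := Finset.mem_range.1 hr
    obtain ⟨w', hw'w, hw'c⟩ := Finset.exists_subset_card_eq (s := w₀) (n := n - (r + 1)) (by omega)
    have hw'W : w' ⊆ w := hw'w.trans (Finset.erase_subset _ _)
    have hb := hB0 (n - (r + 1)) l
    have h1 : |(∏ i, η i ^ l i) / (∏ i, (Nat.factorial (l i) : ℝ))| ≤ h j ^ (r + 1) := by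
      rw [abs_div]
      refine (div_le_self (abs_nonneg _) (one_le_abs_prod_factorial l)).trans ?_
      · rw [Finset.abs_prod, ← hl', ← Finset.prod_pow_eq_pow_sum]
        refine Finset.prod_le_prod (fun i _ => abs_nonneg _) fun i _ => ?_
        rw [abs_pow]
        exact pow_le_pow_left₀ (abs_nonneg _) (hηh i) _
    have hP0' : 0 ≤ ∏ i ∈ w', h i := Finset.prod_nonneg fun i _ => hh0 i
    have h2 : |rdiff p w₀ (D (k + l)) x x'| ≤
        2 ^ n * (B (n - (r + 1)) l * ∏ i ∈ w', h i) := by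
      have h3 := abs_rdiff_union_le p (w := w') (t := w₀ \ w') (f := D (k + l)) (x' := x')
        (M := B (n - (r + 1)) l * ∏ i ∈ w', h i) Finset.sdiff_disjoint x fun V => by
          refine hB (n - (r + 1)) l (by omega) ?_ w' hw'c _ (hmix x hx x' hx' V) x' hx' h
            (fun q => ?_) hh0 hhH
          · simp only [Pi.add_apply, Finset.sum_add_distrib, hl']; omega
          · simp only [mix]; split_ifs
            · simpa using hh0 _
            · exact hh q
      rw [Finset.sdiff_union_of_subset hw'w] at h3
      refine h3.trans (mul_le_mul_of_nonneg_right (pow_le_pow_right₀ one_le_two ?_)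
        (by positivity))
      have := Finset.card_le_card (Finset.sdiff_subset (s := w₀) (t := w'))
      omega
    have h4 := pow_mul_prod_le (h := h) (a := h j) (r := r + 1) (N := N) hw'W
      (by rw [Finset.card_sdiff_of_subset hw'W]; omega) (by omega) (hh0 j) (hhH j) hH hjmin
    rw [abs_mul]
    calc _ ≤ h j ^ (r + 1) * (2 ^ n * (B (n - (r + 1)) l * ∏ i ∈ w', h i)) :=
          mul_le_mul h1 h2 (abs_nonneg _) (pow_nonneg (hh0 j) _)
      _ = 2 ^ n * B (n - (r + 1)) l * (h j ^ (r + 1) * ∏ i ∈ w', h i) := by ring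
      _ ≤ 2 ^ n * B (n - (r + 1)) l * (H ^ N * ∏ i ∈ w, h i) :=
          mul_le_mul_of_nonneg_left h4 (by positivity)
      _ = _ := by ring
  have hrem : |∑ V ∈ w₀.powerset, (-1) ^ V.card * Rm V| ≤ 2 ^ n * (R * H ^ N) * ∏ i ∈ w, h i := by
    have h4 := pow_mul_prod_le (w := w) (w' := ∅) (h := h) (a := h j) (r := m) (N := N)
      (Finset.empty_subset _) (by rw [Finset.sdiff_empty]; omega) (by omega) (hh0 j) (hhH j) hH
      hjmin
    rw [Finset.prod_empty, mul_one] at h4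
    calc _ ≤ ∑ V ∈ w₀.powerset, R * h j ^ m := by
          refine (Finset.abs_sum_le_sum_abs _ _).trans (Finset.sum_le_sum fun V hV => ?_)
          simpa [abs_mul] using hRmb V hV
      _ = 2 ^ w₀.card * (R * h j ^ m) := by simp [Finset.card_powerset]
      _ ≤ 2 ^ n * (R * (H ^ N * ∏ i ∈ w, h i)) := by
          have hj0 := hh0 j
          refine mul_le_mul (pow_le_pow_right₀ one_le_two (by omega))
            (mul_le_mul_of_nonneg_left h4 hR0) (by positivity) (by positivity)
      _ = _ := by ring
  rw [hexp]
  refine (abs_sub _ _).trans ?_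
  rw [abs_neg, add_mul, Finset.sum_mul]
  refine add_le_add ((Finset.abs_sum_le_sum_abs _ _).trans (Finset.sum_le_sum fun r hr => ?_)) hrem
  rw [Finset.sum_mul]
  exact (Finset.abs_sum_le_sum_abs _ _).trans (Finset.sum_le_sum fun l hl => hterm r hr l hl)

end whitney

/-! ### Rectangular differences of smooth functions on Sobol' extensible sets -/

section sobol

variable {ι κ : Type*} [DecidableEq ι]

/-- Taylor expansion with integral remainder about the anchor `c`, applied in the coordinates of
the list in turn. If `g v` are the mixed partial derivatives of `f` on a Sobol' extensible set,
continued by `0`, this reproduces `g v` on that set and defines an extension of it to the whole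
space that is Lipschitz in each rectangular difference. -/
noncomputable def anchoredExt (c : ι → ℝ) (g : Finset ι → (ι → ℝ) → ℝ) :
    List ι → Finset ι → (ι → ℝ) → ℝ
  | [], v => g v
  | i :: L, v => fun x => anchoredExt c g L v (Function.update x i (c i)) +
      ∫ r in (c i)..(x i), anchoredExt c g L (insert i v) (Function.update x i r)

lemma measurable_update_prod (i : ι) :
    Measurable fun z : (ι → ℝ) × ℝ => Function.update z.1 i z.2 := by
  refine measurable_pi_iff.2 fun q => ?_
  by_cases hq : q = i
  · subst hq; simpa using measurable_snd
  · simp only [Function.update_of_ne hq]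
    exact (measurable_pi_apply q).comp measurable_fst

lemma measurable_anchoredExt {c : ι → ℝ} {g : Finset ι → (ι → ℝ) → ℝ} (hg : ∀ v, Measurable (g v))
    (L : List ι) (v : Finset ι) : Measurable (anchoredExt c g L v) := by
  induction L generalizing v with
  | nil => exact hg v
  | cons i L ih =>
    refine ((ih v).comp (measurable_update_prod i |>.comp
      (measurable_id.prodMk measurable_const))).add ?_
    have hH : Measurable fun z : (ι → ℝ) × ℝ =>
        anchoredExt c g L (insert i v) (Function.update z.1 i z.2) :=
      (ih _).comp (measurable_update_prod i)
    have hxi : Measurable fun z : (ι → ℝ) × ℝ => z.1 i :=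
      (measurable_pi_apply i).comp measurable_fst
    have h1 : MeasurableSet {z : (ι → ℝ) × ℝ | z.2 ∈ Set.Ioc (c i) (z.1 i)} :=
      (measurableSet_lt measurable_const measurable_snd).inter
        (measurableSet_le measurable_snd hxi)
    have h2 : MeasurableSet {z : (ι → ℝ) × ℝ | z.2 ∈ Set.Ioc (z.1 i) (c i)} :=
      (measurableSet_lt hxi measurable_snd).inter
        (measurableSet_le measurable_snd measurable_const)
    have e1 := (StronglyMeasurable.integral_prod_right (ν := (volume : Measure ℝ))
      (f := fun (x : ι → ℝ) (r : ℝ) => {z : (ι → ℝ) × ℝ | z.2 ∈ Set.Ioc (c i) (z.1 i)}.indicator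
        (fun z => anchoredExt c g L (insert i v) (Function.update z.1 i z.2)) (x, r))
      (hH.indicator h1).stronglyMeasurable).measurable
    have e2 := (StronglyMeasurable.integral_prod_right (ν := (volume : Measure ℝ))
      (f := fun (x : ι → ℝ) (r : ℝ) => {z : (ι → ℝ) × ℝ | z.2 ∈ Set.Ioc (z.1 i) (c i)}.indicator
        (fun z => anchoredExt c g L (insert i v) (Function.update z.1 i z.2)) (x, r))
      (hH.indicator h2).stronglyMeasurable).measurable
    convert! e1.sub e2 using 1
    ext x
    simp only [intervalIntegral, Pi.sub_apply]
    rw [← integral_indicator measurableSet_Ioc, ← integral_indicator measurableSet_Ioc]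
    rfl

lemma mix_update [DecidableEq κ] (p : ι → κ) (V : Finset κ) (x x' : ι → ℝ) (i : ι) (r : ℝ) :
    mix p V (Function.update x i r) (Function.update x' i r) =
      Function.update (mix p V x x') i r := by
  ext q
  by_cases hq : q = i
  · subst hq; simp [mix]
  · simp [mix, Function.update_of_ne hq]

lemma rdiff_update [DecidableEq κ] (p : ι → κ) (w : Finset κ) (f : (ι → ℝ) → ℝ)
    (x x' : ι → ℝ) (i : ι) (r : ℝ) :
    rdiff p w (fun z => f (Function.update z i r)) x x' =
      rdiff p w f (Function.update x i r) (Function.update x' i r) := by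
  simp only [rdiff, mix_update]

lemma abs_update_le {R r : ℝ} {x : ι → ℝ} {i : ι} (hx : ∀ q, |x q| ≤ R) (hr : |r| ≤ R) (q : ι) :
    |Function.update x i r q| ≤ R := by
  by_cases hq : q = i
  · subst hq; simpa using hr
  · simpa [Function.update_of_ne hq] using hx q

lemma abs_le_of_mem_uIoc {α β r R : ℝ} (hα : |α| ≤ R) (hβ : |β| ≤ R) (hr : r ∈ Set.uIoc α β) :
    |r| ≤ R := by
  rw [abs_le] at *
  rcases Set.mem_uIoc.1 hr with h | h
  · exact ⟨by linarith [h.1], by linarith [h.2]⟩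
  · exact ⟨by linarith [h.1], by linarith [h.2]⟩

/-- A function that is an integral in the coordinate `i` has the rectangular differences of its
integrand, integrated. -/
lemma abs_rdiff_integral_le [DecidableEq κ] (p : ι → κ) {H : (ι → ℝ) → ℝ} (hH : Measurable H)
    {w : Finset κ} {x x' : ι → ℝ} {i : ι} {R M B α β : ℝ} (hx : ∀ q, |x q| ≤ R)
    (hx' : ∀ q, |x' q| ≤ R) (hα : |α| ≤ R) (hβ : |β| ≤ R)
    (hM : ∀ z : ι → ℝ, (∀ q, |z q| ≤ R) → |H z| ≤ M)
    (hB : ∀ r, |r| ≤ R →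
      |rdiff p w H (Function.update x i r) (Function.update x' i r)| ≤ B) :
    |rdiff p w (fun z => ∫ r in α..β, H (Function.update z i r)) x x'| ≤ B * |β - α| := by
  have hint : ∀ V, IntervalIntegrable (fun r => H (Function.update (mix p V x x') i r))
      volume α β := fun V => by
    rw [intervalIntegrable_iff]
    refine Measure.integrableOn_of_bounded (M := M) (by simp [Set.uIoc]) ?_ ?_
    · exact (hH.comp ((measurable_update_prod i).comp
        (measurable_const.prodMk measurable_id))).aestronglyMeasurable
    · refine (ae_restrict_iff' measurableSet_uIoc).2 (ae_of_all _ fun r hr => ?_)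
      exact hM _ (abs_update_le (abs_mix_le p hx hx' V) (abs_le_of_mem_uIoc hα hβ hr))
  have : rdiff p w (fun z => ∫ r in α..β, H (Function.update z i r)) x x' =
      ∫ r in α..β, rdiff p w H (Function.update x i r) (Function.update x' i r) := by
    simp only [rdiff, mix_update]
    rw [intervalIntegral.integral_finsetSum fun V _ => (hint V).const_mul _]
    simp only [intervalIntegral.integral_const_mul]
  rw [this, ← Real.norm_eq_abs]
  exact intervalIntegral.norm_integral_le_of_norm_le_const fun r hr =>
    hB r (abs_le_of_mem_uIoc hα hβ hr)

/-- In the cube `[-R, R] ^ ι` the extension has block differences bounded by the product of the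
block distances, for points that differ only in the coordinates that have been integrated. -/
lemma exists_rdiff_anchoredExt_bound [DecidableEq κ] (p : ι → κ) {c : ι → ℝ}
    {g : Finset ι → (ι → ℝ) → ℝ} (hg : ∀ v, Measurable (g v)) {M : ℝ} (hM : ∀ v x, |g v x| ≤ M)
    {R : ℝ} (hc : ∀ q, |c q| ≤ R) (L : List ι) :
    ∃ C : ℝ, 0 ≤ C ∧ ∀ (v : Finset ι) (w : Finset κ) (x x' : ι → ℝ) (h : κ → ℝ),
      (∀ q, |x q| ≤ R) → (∀ q, |x' q| ≤ R) → (∀ q ∉ L, x q = x' q) →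
      (∀ q, |x' q - x q| ≤ h (p q)) → (∀ j, 0 ≤ h j) →
        |rdiff p w (anchoredExt c g L v) x x'| ≤ C * ∏ j ∈ w, h j := by
  induction L with
  | nil =>
    refine ⟨|M|, abs_nonneg M, fun v w x x' h _ _ hxx _ hh0 => ?_⟩
    have hx : x = x' := funext fun q => hxx q (by simp)
    subst hx
    rcases w.eq_empty_or_nonempty with rfl | ⟨j, hj⟩
    · simpa [rdiff_empty, anchoredExt] using (hM v x).trans (le_abs_self M)
    · rw [← Finset.insert_erase hj, rdiff_insert p (Finset.notMem_erase _ _)]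
      have : mix p {j} x x = x := by ext q; simp [mix]
      rw [this, sub_self, abs_zero]
      exact mul_nonneg (abs_nonneg M) (Finset.prod_nonneg fun i _ => hh0 i)
  | cons i L ih =>
    obtain ⟨C, hC0, hC⟩ := ih
    refine ⟨C + C * (2 * |R|) + C, by positivity, fun v w x x' h hx hx' hxx hh hh0 => ?_⟩
    have hP0 : ∀ w : Finset κ, 0 ≤ ∏ j ∈ w, h j := fun w => Finset.prod_nonneg fun j _ => hh0 j
    -- replacing coordinate `i` of both points keeps the hypotheses, for the shorter list
    have hupd : ∀ (v : Finset ι) (w : Finset κ) (y : ι → ℝ) (r : ℝ), (∀ q, |y q| ≤ R) →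
        |r| ≤ R → (∀ q, q ∉ i :: L → y q = x' q) → (∀ q, |x' q - y q| ≤ h (p q)) →
        |rdiff p w (anchoredExt c g L v) (Function.update y i r) (Function.update x' i r)| ≤
          C * ∏ j ∈ w, h j := by
      intro v w y r hy hr hyx hyh
      refine hC v w _ _ h (abs_update_le hy hr) (abs_update_le hx' hr) (fun q hq => ?_)
        (fun q => ?_) hh0
      · by_cases hqi : q = i
        · subst hqi; simp
        · simpa [Function.update_of_ne hqi] using hyx q (by simp [hqi, hq])
      · by_cases hqi : q = i
        · subst hqi; simpa using hh0 _
        · simpa [Function.update_of_ne hqi] using hyh q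
    have hbd : ∀ z : ι → ℝ, (∀ q, |z q| ≤ R) → |anchoredExt c g L (insert i v) z| ≤ C := by
      intro z hz
      simpa [rdiff_empty] using hC (insert i v) ∅ z z (fun _ => 0) hz hz (by simp) (by simp)
        (by simp)
    have hmeas := measurable_anchoredExt (c := c) hg L (insert i v)
    set Hf := anchoredExt c g L (insert i v) with hHf
    have h1 : |rdiff p w (fun z => anchoredExt c g L v (Function.update z i (c i))) x x'| ≤
        C * ∏ j ∈ w, h j := by
      rw [rdiff_update]
      exact hupd v w x (c i) hx (hc i) hxx hh
    have h2 : |rdiff p w (fun z => ∫ r in (c i)..(x i), Hf (Function.update z i r)) x x'| ≤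
        C * (2 * |R|) * ∏ j ∈ w, h j := by
      refine (abs_rdiff_integral_le p hmeas hx hx' (hc i) (hx i) hbd
        fun r hr => hupd _ w x r hx hr hxx hh).trans ?_
      have : |x i - c i| ≤ 2 * |R| := (abs_sub _ _).trans (by
        linarith [hx i, hc i, le_abs_self R])
      calc _ ≤ (C * ∏ j ∈ w, h j) * (2 * |R|) :=
            mul_le_mul_of_nonneg_left this (mul_nonneg hC0 (hP0 w))
        _ = _ := by ring
    have h3 : |rdiff p w (fun z => ∫ r in (x i)..(z i), Hf (Function.update z i r)) x x'| ≤
        C * ∏ j ∈ w, h j := by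
      by_cases hj : p i ∈ w
      · obtain ⟨w₀, hj₀, rfl⟩ : ∃ w₀, p i ∉ w₀ ∧ insert (p i) w₀ = w :=
          ⟨w.erase (p i), Finset.notMem_erase _ _, Finset.insert_erase hj⟩
        rw [rdiff_insert p hj₀, rdiff_congr p (f' := fun _ => 0), rdiff_congr p (w := w₀)
          (x := mix p {p i} x x')
          (f' := fun z => ∫ r in (x i)..(x' i), Hf (Function.update z i r))]
        · have hm : ∀ q, |mix p {p i} x x' q| ≤ R := abs_mix_le p hx hx' _
          have := abs_rdiff_integral_le p (w := w₀) (i := i) hmeas hm hx' (hx i) (hx' i)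
            hbd (B := C * ∏ j ∈ w₀, h j) fun r hr => by
              refine hupd _ w₀ (mix p {p i} x x') r hm hr (fun q hq => ?_) fun q => ?_
              · simp only [mix]; split_ifs
                · rfl
                · exact hxx q hq
              · simp only [mix]; split_ifs
                · simpa using hh0 _
                · exact hh q
          rw [Finset.prod_insert hj₀]
          calc _ = _ := by simp [rdiff]
            _ ≤ _ := this
            _ ≤ (C * ∏ j ∈ w₀, h j) * h (p i) :=
              mul_le_mul_of_nonneg_left (hh i) (mul_nonneg hC0 (hP0 w₀))
            _ = _ := by ring
        · intro V hV
          have : mix p V (mix p {p i} x x') x' i = x' i := by simp [mix]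
          simp only [this]
        · intro V hV
          have : mix p V x x' i = x i := by
            simp only [mix]; rw [if_neg fun hh => hj₀ (hV hh)]
          simp [this]
      · rw [rdiff_congr p (f' := fun _ => 0)]
        · simpa [rdiff] using mul_nonneg hC0 (hP0 w)
        · intro V hV
          have : mix p V x x' i = x i := by
            simp only [mix]; rw [if_neg fun hh => hj (hV hh)]
          simp [this]
    have hsum : rdiff p w (anchoredExt c g (i :: L) v) x x' =
        rdiff p w (fun z => anchoredExt c g L v (Function.update z i (c i))) x x' +
        (rdiff p w (fun z => ∫ r in (c i)..(x i), Hf (Function.update z i r)) x x' +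
        rdiff p w (fun z => ∫ r in (x i)..(z i), Hf (Function.update z i r)) x x') := by
      rw [← rdiff_add, ← rdiff_add]
      refine rdiff_congr p fun V _ => ?_
      simp only [anchoredExt]
      rw [intervalIntegral.integral_add_adjacent_intervals]
      all_goals
        rw [intervalIntegrable_iff]
        refine Measure.integrableOn_of_bounded (M := C) (by simp [Set.uIoc]) ?_ ?_
        · exact (hmeas.comp ((measurable_update_prod i).comp
            (measurable_const.prodMk measurable_id))).aestronglyMeasurable
        · refine (ae_restrict_iff' measurableSet_uIoc).2 (ae_of_all _ fun r hr => ?_)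
          have hm := abs_mix_le p hx hx' V
          exact hbd _ (abs_update_le hm (abs_le_of_mem_uIoc (by first | exact hc i | exact hx i)
            (by first | exact hx i | exact hm i) hr))
    rw [hsum]
    calc _ ≤ _ := (abs_add_le _ _).trans (add_le_add h1 ((abs_add_le _ _).trans (add_le_add h2 h3)))
      _ = _ := by ring

/-- On the set itself the extension reproduces the partial derivatives, by the fundamental theorem
of calculus along the segments to the anchor. -/
lemma anchoredExt_eq {X : Set (ι → ℝ)} {c : ι → ℝ} (hcX : ∀ z ∈ X, Set.uIcc c z ⊆ X)
    {g : Finset ι → (ι → ℝ) → ℝ} (hgc : ∀ v, ContinuousOn (g v) X)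
    (hgd : ∀ v, ∀ i ∉ v, ∀ x ∈ X,
      HasDerivWithinAt (fun r => g v (Function.update x i r)) (g (insert i v) x)
        {r | Function.update x i r ∈ X} (x i))
    (L : List ι) (hL : L.Nodup) (v : Finset ι) (hv : ∀ i ∈ L, i ∉ v) {x : ι → ℝ} (hx : x ∈ X) :
    anchoredExt c (fun v => X.indicator (g v)) L v x = g v x := by
  induction L generalizing v x with
  | nil => simp [anchoredExt, hx]
  | cons i L ih =>
    rw [List.nodup_cons] at hL
    have hiv : i ∉ v := hv i (by simp)
    have hseg : ∀ r ∈ Set.uIcc (c i) (x i), Function.update x i r ∈ X := fun r hr => by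
      refine hcX x hx ?_
      rw [Set.mem_uIcc] at hr
      rw [Set.uIcc, Set.mem_Icc, Pi.le_def, Pi.le_def, ← forall_and]
      intro q
      by_cases hq : q = i
      · subst hq
        rcases hr with h | h <;> simp [h.1, h.2]
      · simp [Function.update_of_ne hq]
    have hupd : Continuous fun r : ℝ => Function.update x i r :=
      continuous_const.update i continuous_id
    have hcont : ∀ v, ContinuousOn (fun r => g v (Function.update x i r))
        (Set.uIcc (c i) (x i)) := fun v =>
      (hgc v).comp hupd.continuousOn hseg
    simp only [anchoredExt]
    rw [ih hL.2 v (fun q hq => hv q (by simp [hq])) (hseg _ Set.left_mem_uIcc),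
      intervalIntegral.integral_congr (g := fun r => g (insert i v) (Function.update x i r)),
      intervalIntegral.integral_eq_sub_of_hasDeriv_right
        (f := fun r => g v (Function.update x i r))]
    · simp
    · exact hcont v
    · intro r hr
      have hr' : r ∈ Set.uIcc (c i) (x i) := Set.Ioo_subset_Icc_self hr
      have h1 := hgd v i hiv _ (hseg r hr')
      simp only [Function.update_idem, Function.update_self] at h1
      have h2 : {r | Function.update x i r ∈ X} ∈ 𝓝 r :=
        Filter.mem_of_superset (Icc_mem_nhds hr.1 hr.2) hseg
      exact (h1.hasDerivAt h2).hasDerivWithinAt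
    · exact (hcont _).intervalIntegrable
    · intro r hr
      refine ih hL.2 _ (fun q hq => ?_) (hseg r hr)
      rw [Finset.mem_insert, not_or]
      exact ⟨fun h => hL.1 (h ▸ hq), hv q (by simp [hq])⟩

/-- On a compact Sobol' extensible set, the mixed difference of a smooth function over any blocks is
at most a constant times the product of the block distances. -/
lemma exists_rdiff_bound_of_sobolExtensible [Fintype ι] [DecidableEq κ] (p : ι → κ)
    {X : Set (ι → ℝ)} (hXc : IsCompact X) (hX : IsSobolExtensible X) {f : (ι → ℝ) → ℝ}
    (hf : IsSmoothOn f X) (hmix : ∀ x ∈ X, ∀ x' ∈ X, ∀ V, mix p V x x' ∈ X) :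
    ∃ C : ℝ, 0 ≤ C ∧ ∀ w : Finset κ, ∀ x ∈ X, ∀ x' ∈ X, ∀ h : κ → ℝ,
      (∀ q, |x' q - x q| ≤ h (p q)) → (∀ j, 0 ≤ h j) →
        |rdiff p w f x x'| ≤ C * ∏ j ∈ w, h j := by
  obtain ⟨hXcl, -, c, hcX, hc⟩ := hX
  obtain ⟨g, hg0, hgc, hgd⟩ := hf
  obtain ⟨R, hR⟩ := hXc.isBounded.exists_norm_le
  have hR' : ∀ x ∈ X, ∀ q, |x q| ≤ R := fun x hx q => (norm_le_pi_norm x q).trans (hR x hx)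
  choose M hM using fun v => hXc.exists_bound_of_continuousOn (hgc v)
  have hM0 : ∀ v, 0 ≤ M v := fun v => (norm_nonneg _).trans (hM v c hcX)
  have hmeas : ∀ v, Measurable (X.indicator (g v)) := fun v => by
    classical
    rw [← Set.piecewise_eq_indicator]
    exact (hgc v).measurable_piecewise continuousOn_const hXcl.measurableSet
  obtain ⟨C, hC0, hC⟩ := exists_rdiff_anchoredExt_bound p (c := c) hmeas (M := ∑ v, M v)
    (fun v x => by
      by_cases hx : x ∈ X
      · rw [Set.indicator_of_mem hx]
        exact (hM v x hx).trans (Finset.single_le_sum (fun v _ => hM0 v) (Finset.mem_univ v))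
      · simpa [hx] using Finset.sum_nonneg fun v _ => hM0 v)
    (hR' c hcX) Finset.univ.toList
  refine ⟨C, hC0, fun w x hx x' hx' h hh hh0 => ?_⟩
  rw [rdiff_congr p (f' := anchoredExt c (fun v => X.indicator (g v)) Finset.univ.toList ∅)]
  · exact hC ∅ w x x' h (hR' x hx) (hR' x' hx') (by simp) hh hh0
  · intro V _
    have hm := hmix x hx x' hx' V
    rw [anchoredExt_eq hc hgc hgd _ (Finset.nodup_toList _) ∅ (by simp) hm, hg0 _ hm]

end sobol

/-! ### Limit points of recursive splits -/

section split

variable {b d : ℕ}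

/-- The point to which the cells along the digit sequence `y` converge nicely. -/
noncomputable def limitPoint (cell : List (Fin b) → Set (EuclideanSpace ℝ (Fin d)))
    (y : ℕ → Fin b) : EuclideanSpace ℝ (Fin d) :=
  Classical.epsilon fun p => ConvergesNicely (fun K => cell (List.ofFn fun i : Fin K => y i)) p

lemma splitTransform_eq_limitPoint [NeZero b]
    (cell : List (Fin b) → Set (EuclideanSpace ℝ (Fin d))) (x : ℝ) :
    splitTransform cell x = limitPoint cell (Real.digits x b) := rfl

lemma volume_cube (z : EuclideanSpace ℝ (Fin d)) {r : ℝ} (hr : 0 ≤ r) :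
    volume (cube z r) = ENNReal.ofReal (r ^ d) := by
  have h1 : cube z r = (fun y : EuclideanSpace ℝ (Fin d) => y.ofLp) ⁻¹'
      Set.Icc (fun i => z i) (fun i => z i + r) := by
    ext y
    simp only [cube, Set.mem_ofPred_eq, Set.mem_preimage, Set.mem_Icc, Pi.le_def, forall_and]
  rw [h1, (PiLp.volume_preserving_ofLp (Fin d)).measure_preimage
    measurableSet_Icc.nullMeasurableSet, Real.volume_Icc_pi]
  simp [ENNReal.ofReal_pow hr]

variable {X : Set (EuclideanSpace ℝ (Fin d))}
  {cell : List (Fin b) → Set (EuclideanSpace ℝ (Fin d))}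

lemma IsRecursiveSplit.cell_append_subset (h : IsRecursiveSplit b X cell) (w : List (Fin b))
    (a : Fin b) : cell (w ++ [a]) ⊆ cell w := by
  rw [(h.2 w).2.2.2.1]
  exact Set.subset_iUnion (fun a => cell (w ++ [a])) a

lemma IsRecursiveSplit.antitone (h : IsRecursiveSplit b X cell) (y : ℕ → Fin b) :
    Antitone fun K : ℕ => cell (List.ofFn fun i : Fin K => y i) := by
  refine antitone_nat_of_succ_le fun K => ?_
  rw [List.ofFn_succ_last]
  exact h.cell_append_subset _ _

lemma IsRecursiveSplit.volume_cell (h : IsRecursiveSplit b X cell) (y : ℕ → Fin b) (K : ℕ) :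
    volume (cell (List.ofFn fun i : Fin K => y i)) = volume X * ((b : ENNReal)⁻¹) ^ K := by
  induction K with
  | zero => simp [h.1]
  | succ K ih =>
    rw [List.ofFn_succ_last, (h.2 _).2.2.2.2.1]
    simp only [Fin.val_castSucc, ih, pow_succ, div_eq_mul_inv, mul_assoc]

/-- Nice convergence puts the limit point within the diameter of a small cube of every deep cell,
so it is in the closure of each cell along the sequence. -/
lemma limitPoint_mem_closure_cell (hb : 2 ≤ b) (hd : 1 ≤ d) (h : IsRecursiveSplit b X cell)
    (hconv : IsConvergentSplit cell) (y : ℕ → Fin b) (K : ℕ) :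
    limitPoint cell y ∈ closure (cell (List.ofFn fun i : Fin K => y i)) := by
  obtain ⟨⟨α, z, r, hz⟩, -⟩ : ConvergesNicely _ (limitPoint cell y) :=
    Classical.epsilon_spec (hconv y)
  have hX : volume X < ⊤ := by rw [← h.1]; exact (h.2 []).2.1
  have hr0 : ∀ k, 0 ≤ r k := fun k => by
    have := (hz k).1 ⟨0, hd⟩
    linarith [this.1.trans this.2]
  -- the volumes of the cells tend to zero, so the sides of the cubes do
  have hrk : Tendsto r atTop (𝓝 0) := by
    have h1 : ∀ k, r k ^ d ≤ (α * (volume X).toReal) * ((b : ℝ)⁻¹) ^ k := fun k => by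
      have h2 := (hz k).2.2.2
      rw [volume_cube _ (hr0 k), h.volume_cell] at h2
      have h3 := ENNReal.toReal_mono (ENNReal.mul_ne_top ENNReal.coe_ne_top
        (ENNReal.mul_ne_top hX.ne (ENNReal.pow_ne_top (by simp; omega)))) h2
      rw [ENNReal.toReal_ofReal (pow_nonneg (hr0 k) _)] at h3
      simpa [mul_assoc] using h3
    have hb1 : ((b : ℝ)⁻¹) < 1 := inv_lt_one_of_one_lt₀ (by exact_mod_cast hb)
    have h4 : Tendsto (fun k => r k ^ d) atTop (𝓝 0) := by
      refine squeeze_zero (fun k => pow_nonneg (hr0 k) _) h1 ?_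
      simpa using (tendsto_pow_atTop_nhds_zero_of_lt_one (by positivity) hb1).const_mul
        (α * (volume X).toReal)
    have hd0 : (0 : ℝ) < (d : ℝ)⁻¹ := by
      have : 0 < d := hd
      positivity
    have h5 := h4.rpow_const (p := (d : ℝ)⁻¹) (Or.inr hd0.le)
    rw [Real.zero_rpow hd0.ne'] at h5
    exact h5.congr fun k => Real.pow_rpow_inv_natCast (hr0 k) (by omega)
  have hne : ∀ k, (cell (List.ofFn fun i : Fin k => y i)).Nonempty := fun k =>
    nonempty_of_measure_ne_zero (h.2 _).1.ne'
  choose p hp using hne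
  have hlim : Tendsto p atTop (𝓝 (limitPoint cell y)) := by
    have h6 : Tendsto (fun k => (p k).ofLp) atTop (𝓝 (limitPoint cell y).ofLp) := by
      refine tendsto_pi_nhds.2 fun i => ?_
      rw [tendsto_iff_dist_tendsto_zero]
      refine squeeze_zero (fun _ => dist_nonneg) (fun k => ?_) hrk
      have h7 := (hz k).1 i
      have h8 := (hz k).2.1 (hp k) i
      rw [Real.dist_eq, abs_le]
      constructor <;> linarith [h7.1, h7.2, h8.1, h8.2]
    exact ((PiLp.continuous_toLp 2 _).tendsto _).comp h6
  refine mem_closure_of_tendsto hlim ?_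
  filter_upwards [eventually_ge_atTop K] with k hk
  exact h.antitone y hk (hp k)

/-- Limit points of digit sequences that share `k` digits lie in the closure of one cell of level
`k`, whose diameter the sphericity condition bounds. -/
lemma exists_dist_limitPoint_le (hb : 2 ≤ b) (hd : 1 ≤ d) (h : IsRecursiveSplit b X cell)
    (hconv : IsConvergentSplit cell) (hsph : SatisfiesSphericity cell) :
    ∃ C : ℝ, 0 ≤ C ∧ ∀ (y y' : ℕ → Fin b) (k : ℕ), (∀ i < k, y i = y' i) →
      dist (limitPoint cell y) (limitPoint cell y') ≤ C * ((b : ℝ) ^ (-(1 / (d : ℝ)))) ^ k := by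
  obtain ⟨C, hC⟩ := hsph
  refine ⟨|C|, abs_nonneg C, fun y y' k hk => ?_⟩
  have h1 := limitPoint_mem_closure_cell hb hd h hconv y k
  have h2 := limitPoint_mem_closure_cell hb hd h hconv y' k
  rw [show (fun i : Fin k => y' i) = fun i : Fin k => y i from
    funext fun i => (hk i i.2).symm] at h2
  have h3 := Metric.edist_le_ediam_of_mem h1 h2
  rw [Metric.ediam_closure] at h3
  have h4 := h3.trans (hC _)
  rw [List.length_ofFn] at h4
  have h5 : ((b : ℝ) ^ (-(1 / (d : ℝ)))) ^ k = (b : ℝ) ^ (-((k : ℝ) / (d : ℝ))) := by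
    rw [← Real.rpow_natCast, ← Real.rpow_mul (by positivity)]
    congr 1; ring
  have h6 : C * (b : ℝ) ^ (-((k : ℝ) / (d : ℝ))) ≤ |C| * (b : ℝ) ^ (-((k : ℝ) / (d : ℝ))) :=
    mul_le_mul_of_nonneg_right (le_abs_self C) (by positivity)
  rw [h5]
  rw [edist_dist] at h4
  exact (ENNReal.ofReal_le_ofReal_iff (by positivity)).1 (h4.trans (ENNReal.ofReal_le_ofReal h6))

end split

/-! ### The integrand as a function of the digits -/

section integrand

variable {b s d : ℕ}

/-- The integrand, as a function of the `s` digit sequences of its arguments. -/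
noncomputable def digitIntegrand (cell : Fin s → List (Fin b) → Set (EuclideanSpace ℝ (Fin d)))
    (f : (Fin s × Fin d → ℝ) → ℝ) (y : Fin s → ℕ → Fin b) : ℝ :=
  f (concat fun j => limitPoint (cell j) (y j))

lemma continuous_concat : Continuous (concat : (Fin s → EuclideanSpace ℝ (Fin d)) → _) := by
  unfold concat; fun_prop

lemma mix_concat (V : Finset (Fin s)) (x x' : Fin s → EuclideanSpace ℝ (Fin d)) :
    mix Prod.fst V (concat x) (concat x') = concat (mix id V x x') := by
  ext q
  simp only [mix, concat, id]
  split_ifs <;> rfl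

lemma isCompact_prodSet {X : Fin s → Set (EuclideanSpace ℝ (Fin d))}
    (hX : ∀ j, Bornology.IsBounded (X j)) (hc : IsClosed (prodSet X)) :
    IsCompact (prodSet X) := by
  have h1 : IsCompact (concat '' Set.univ.pi fun j => closure (X j)) :=
    (isCompact_univ_pi fun j => (hX j).isCompact_closure).image continuous_concat
  exact h1.of_isClosed_subset hc
    (Set.image_mono (Set.pi_mono fun j _ => subset_closure))

lemma concat_mem_prodSet {X : Fin s → Set (EuclideanSpace ℝ (Fin d))} (hc : IsClosed (prodSet X))
    {x : Fin s → EuclideanSpace ℝ (Fin d)} (hx : ∀ j, x j ∈ closure (X j)) :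
    concat x ∈ prodSet X := by
  rw [← hc.closure_eq]
  refine image_closure_subset_closure_image continuous_concat ⟨x, ?_, rfl⟩
  rw [closure_pi_set]
  exact fun j _ => hx j

lemma mix_mem_prodSet {X : Fin s → Set (EuclideanSpace ℝ (Fin d))} {x x' : Fin s × Fin d → ℝ}
    (hx : x ∈ prodSet X) (hx' : x' ∈ prodSet X) (V : Finset (Fin s)) :
    mix Prod.fst V x x' ∈ prodSet X := by
  obtain ⟨z, hz, rfl⟩ := hx
  obtain ⟨z', hz', rfl⟩ := hx'
  rw [mix_concat]
  refine ⟨_, fun j _ => ?_, rfl⟩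
  simp only [mix]
  split_ifs
  · exact hz' j trivial
  · exact hz j trivial

/-- Under both smoothness hypotheses, rectangular differences over blocks are bounded by the
product of the block distances. -/
lemma exists_rdiff_prodSet_bound (hd : 1 ≤ d) {X : Fin s → Set (EuclideanSpace ℝ (Fin d))}
    (hX : ∀ j, Bornology.IsBounded (X j)) {f : (Fin s × Fin d → ℝ) → ℝ}
    (hf : (IsSobolExtensible (prodSet X) ∧ IsSmoothOn f (prodSet X)) ∨
      ((∀ j, IsClosed (X j)) ∧ IsWhitneyC (d * s) f (prodSet X))) {H : ℝ} (hH : 1 ≤ H) :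
    IsClosed (prodSet X) ∧ ∃ C : ℝ, 0 ≤ C ∧ ∀ w : Finset (Fin s), ∀ x ∈ prodSet X,
      ∀ x' ∈ prodSet X, ∀ h : Fin s → ℝ, (∀ q, |x' q - x q| ≤ h q.1) → (∀ j, 0 ≤ h j) →
      (∀ j, h j ≤ H) → |rdiff Prod.fst w f x x'| ≤ C * ∏ j ∈ w, h j := by
  have hmix : ∀ x ∈ prodSet X, ∀ x' ∈ prodSet X, ∀ V, mix Prod.fst V x x' ∈ prodSet X :=
    fun x hx x' hx' V => mix_mem_prodSet hx hx' V
  rcases hf with ⟨hS, hf⟩ | ⟨hcl, D, hD0, hD⟩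
  · refine ⟨hS.1, ?_⟩
    obtain ⟨C, hC0, hC⟩ := exists_rdiff_bound_of_sobolExtensible Prod.fst
      (isCompact_prodSet hX hS.1) hS hf hmix
    exact ⟨C, hC0, fun w x hx x' hx' h hh hh0 _ => hC w x hx x' hx' h hh hh0⟩
  · have hcomp : IsCompact (prodSet X) := (isCompact_univ_pi fun j =>
      Metric.isCompact_of_isClosed_isBounded (hcl j) (hX j)).image continuous_concat
    refine ⟨hcomp.isClosed, ?_⟩
    have hJ : IsJet D (d * s) (prodSet X) := hD
    have key : ∀ n : ℕ, ∃ C : ℝ, 0 ≤ C ∧ (n ≤ s → ∀ w : Finset (Fin s), w.card = n →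
        ∀ x ∈ prodSet X, ∀ x' ∈ prodSet X, ∀ h : Fin s → ℝ, (∀ q, |x' q - x q| ≤ h q.1) →
        (∀ j, 0 ≤ h j) → (∀ j, h j ≤ H) →
          |rdiff Prod.fst w (D 0) x x'| ≤ C * ∏ j ∈ w, h j) := fun n => by
      by_cases hn : n ≤ s
      · obtain ⟨C, hC0, hC⟩ := hJ.exists_rdiff_bound hcomp Prod.fst hmix hH n 0
          (by simpa using hn.trans (Nat.le_mul_of_pos_left s hd))
        exact ⟨C, hC0, fun _ => hC⟩
      · exact ⟨0, le_rfl, fun h => absurd h hn⟩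
    choose C hC0 hC using key
    refine ⟨∑ n ∈ Finset.range (s + 1), C n, Finset.sum_nonneg fun n _ => hC0 n,
      fun w x hx x' hx' h hh hh0 hhH => ?_⟩
    have hws : w.card ≤ s := by simpa using w.card_le_univ
    rw [rdiff_congr Prod.fst (f' := D 0) fun V _ => (hD0 _ (hmix x hx x' hx' V)).symm]
    refine (hC w.card hws w rfl x hx x' hx' h hh hh0 hhH).trans
      (mul_le_mul_of_nonneg_right ?_ (Finset.prod_nonneg fun j _ => hh0 j))
    exact Finset.single_le_sum (f := C) (fun n _ => hC0 n) (Finset.mem_range.2 (by omega))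

/-- If the arguments agree in the first `k j` digits of coordinate `j`, the rectangular difference
over `w` gains a factor `b ^ (-k j / d)` from each `j ∈ w`. -/
lemma exists_rdiff_digitIntegrand_bound (hb : 2 ≤ b) (hd : 1 ≤ d)
    {X : Fin s → Set (EuclideanSpace ℝ (Fin d))} (hX : ∀ j, Bornology.IsBounded (X j))
    {cell : Fin s → List (Fin b) → Set (EuclideanSpace ℝ (Fin d))}
    (hsplit : ∀ j, IsRecursiveSplit b (X j) (cell j)) (hconv : ∀ j, IsConvergentSplit (cell j))
    (hsph : ∀ j, SatisfiesSphericity (cell j)) {f : (Fin s × Fin d → ℝ) → ℝ}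
    (hf : (IsSobolExtensible (prodSet X) ∧ IsSmoothOn f (prodSet X)) ∨
      ((∀ j, IsClosed (X j)) ∧ IsWhitneyC (d * s) f (prodSet X))) :
    ∃ C : ℝ, 0 ≤ C ∧ ∀ (w : Finset (Fin s)) (y y' : Fin s → ℕ → Fin b) (k : Fin s → ℕ),
      (∀ j, ∀ i < k j, y j i = y' j i) →
      |rdiff id w (digitIntegrand cell f) y y'| ≤
        C * ∏ j ∈ w, ((b : ℝ) ^ (-(1 / (d : ℝ)))) ^ k j := by
  choose A hA0 hA using fun j => exists_dist_limitPoint_le hb hd (hsplit j) (hconv j) (hsph j)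
  set ρ : ℝ := (b : ℝ) ^ (-(1 / (d : ℝ))) with hρ
  have hρ0 : 0 ≤ ρ := by positivity
  have hρ1 : ρ ≤ 1 := Real.rpow_le_one_of_one_le_of_nonpos (by exact_mod_cast (by omega : 1 ≤ b))
    (by simp)
  set H : ℝ := 1 + ∑ j, A j with hHdef
  have hH : 1 ≤ H := by
    have := Finset.sum_nonneg fun j (_ : j ∈ Finset.univ) => hA0 j
    linarith
  have hAH : ∀ j, A j ≤ H := fun j => by
    have := Finset.single_le_sum (f := A) (fun j _ => hA0 j) (Finset.mem_univ j)
    linarith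
  obtain ⟨hcl, C, hC0, hC⟩ := exists_rdiff_prodSet_bound hd hX hf hH
  have hmem : ∀ y : Fin s → ℕ → Fin b, concat (fun j => limitPoint (cell j) (y j)) ∈ prodSet X :=
    fun y => concat_mem_prodSet hcl fun j => by
      have := limitPoint_mem_closure_cell hb hd (hsplit j) (hconv j) (y j) 0
      simpa [(hsplit j).1] using this
  refine ⟨C * H ^ s, by positivity, fun w y y' k hk => ?_⟩
  have h1 : rdiff id w (digitIntegrand cell f) y y' =
      rdiff Prod.fst w f (concat fun j => limitPoint (cell j) (y j))
        (concat fun j => limitPoint (cell j) (y' j)) := by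
    refine Finset.sum_congr rfl fun V _ => ?_
    rw [mix_concat, digitIntegrand]
    congr 3
    ext1 j
    simp only [mix]
    split_ifs <;> rfl
  rw [h1]
  refine (hC w _ (hmem y) _ (hmem y') (fun j => A j * ρ ^ k j) (fun q => ?_) (fun j => ?_)
    fun j => ?_).trans ?_
  · have h2 := hA q.1 (y q.1) (y' q.1) (k q.1) (hk q.1)
    refine le_trans ?_ h2
    rw [dist_comm, dist_eq_norm]
    exact PiLp.norm_apply_le (limitPoint (cell q.1) (y' q.1) - limitPoint (cell q.1) (y q.1)) q.2
  · have := hA0 j; positivity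
  · exact (mul_le_of_le_one_right (hA0 j) (pow_le_one₀ hρ0 hρ1)).trans (hAH j)
  · rw [Finset.prod_mul_distrib, mul_assoc]
    refine mul_le_mul_of_nonneg_left (mul_le_mul_of_nonneg_right ?_
      (Finset.prod_nonneg fun j _ => by positivity)) hC0
    calc ∏ j ∈ w, A j ≤ ∏ _j ∈ w, H := Finset.prod_le_prod (fun j _ => hA0 j) fun j _ => hAH j
      _ = H ^ w.card := Finset.prod_const H
      _ ≤ H ^ s := pow_le_pow_right₀ hH (by simpa using w.card_le_univ)

end integrand

/-! ### Digit expansions -/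

section digits

variable {b : ℕ}

lemma ofDigits_lt_one (hb : 2 ≤ b) {y : ℕ → Fin b} {k : ℕ} (hk : (y k : ℕ) ≠ b - 1) :
    Real.ofDigits y < 1 := by
  rw [← Real.ofDigits_const_last_eq_one' (b := b) hb]
  refine Summable.tsum_lt_tsum (i := k) (fun i => ?_) ?_ Real.summable_ofDigitsTerm
    Real.summable_ofDigitsTerm
  · simp only [Real.ofDigitsTerm]
    refine mul_le_mul_of_nonneg_right ?_ (by positivity)
    have := (y i).2
    exact_mod_cast (by omega : (y i : ℕ) ≤ b - 1)
  · simp only [Real.ofDigitsTerm]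
    refine mul_lt_mul_of_pos_right ?_ (by positivity)
    have := (y k).2
    exact_mod_cast (by omega : (y k : ℕ) < b - 1)

lemma exists_natCast_eq_pow_mul_sum (hb : 2 ≤ b) (y : ℕ → Fin b) (n : ℕ) :
    ∃ M : ℕ, (b : ℝ) ^ n * ∑ i ∈ Finset.range n, Real.ofDigitsTerm y i = M := by
  have hb0 : (b : ℝ) ≠ 0 := by positivity
  induction n with
  | zero => exact ⟨0, by simp⟩
  | succ n ih =>
    obtain ⟨M, hM⟩ := ih
    refine ⟨b * M + y n, ?_⟩
    push_cast
    rw [Finset.sum_range_succ, mul_add, ← hM, Real.ofDigitsTerm]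
    field_simp
    ring

/-- A digit sequence that does not end in digits `b - 1` is the expansion of its value. -/
lemma digits_ofDigits [NeZero b] (hb : 2 ≤ b) {y : ℕ → Fin b}
    (hy : ∀ k₀, ∃ k ≥ k₀, (y k : ℕ) ≠ b - 1) : Real.digits (Real.ofDigits y) b = y := by
  have hb0 : (b : ℝ) ≠ 0 := by positivity
  ext n
  obtain ⟨M, hM⟩ := exists_natCast_eq_pow_mul_sum hb y n
  obtain ⟨k, hk, hyk⟩ := hy (n + 1)
  have h1 : Real.ofDigits y * (b : ℝ) ^ (n + 1) =
      ((b * M + y n : ℕ) : ℝ) + Real.ofDigits (fun i => y (i + (n + 1))) := by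
    rw [Real.ofDigits_eq_sum_add_ofDigits y (n + 1), Finset.sum_range_succ]
    push_cast
    rw [← hM, Real.ofDigitsTerm]
    field_simp
    ring
  have h2 : ⌊Real.ofDigits y * (b : ℝ) ^ (n + 1)⌋₊ = b * M + y n := by
    have h3 := Real.ofDigits_nonneg (fun i => y (i + (n + 1)))
    rw [h1, Nat.floor_eq_iff (by positivity)]
    refine ⟨le_add_of_nonneg_right h3, ?_⟩
    have := ofDigits_lt_one hb (y := fun i => y (i + (n + 1))) (k := k - (n + 1))
      (by simpa [Nat.sub_add_cancel hk] using hyk)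
    linarith
  rw [Real.digits, h2, Fin.val_ofNat, Nat.mul_add_mod, Nat.mod_eq_of_lt (y n).2]

lemma natFloor_eq_iff_digits_eq [NeZero b] {x x' : ℝ} (hx : x ∈ Set.Ico (0 : ℝ) 1)
    (hx' : x' ∈ Set.Ico (0 : ℝ) 1) (k : ℕ) :
    ⌊(b : ℝ) ^ k * x⌋₊ = ⌊(b : ℝ) ^ k * x'⌋₊ ↔
      ∀ i < k, Real.digits x b i = Real.digits x' b i := by
  have hb0 : (b : ℝ) ≠ 0 := by exact_mod_cast NeZero.ne b
  constructor
  · intro h i hi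
    have key : ∀ z : ℝ, ⌊z * (b : ℝ) ^ (i + 1)⌋₊ = ⌊(b : ℝ) ^ k * z⌋₊ / b ^ (k - (i + 1)) := by
      intro z
      rw [← Nat.floor_div_natCast]
      congr 1
      push_cast
      rw [eq_div_iff (pow_ne_zero _ hb0), mul_assoc, ← pow_add, mul_comm]
      congr 2; omega
    rw [Real.digits, Real.digits, key, key, h]
  · intro h
    have h1 := Real.ofDigits_digits_sum_eq (b := b) hx k
    have h2 := Real.ofDigits_digits_sum_eq (b := b) hx' k
    have h3 : ∑ i ∈ Finset.range k, Real.ofDigitsTerm (Real.digits x b) i =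
        ∑ i ∈ Finset.range k, Real.ofDigitsTerm (Real.digits x' b) i :=
      Finset.sum_congr rfl fun i hi => by
        rw [Real.ofDigitsTerm, Real.ofDigitsTerm, h i (Finset.mem_range.1 hi)]
    rw [h3, h2] at h1
    exact_mod_cast h1.symm

/-- The scaled indicator that `y` and `y'` share their first `k` digits: the density of the
coupling of two uniform sequences that have these digits in common. -/
def digitKernel (k : ℕ) (y y' : ℕ → Fin b) : ℝ :=
  ∏ i ∈ Finset.range k, ((b : ℝ) * if y i = y' i then 1 else 0)

/-- The kernel of the projection onto the functions of the first `k` digits that have mean zero in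
digit `k`; for `k = 0`, onto the constants. -/
def haarKernel : ℕ → (ℕ → Fin b) → (ℕ → Fin b) → ℝ
  | 0, _, _ => 1
  | k + 1, y, y' => digitKernel (k + 1) y y' - digitKernel k y y'

/-- The factor of a gain coefficient in terms of the digits, with index shifted by one so that
index `0` stands for a coordinate outside `u`. -/
noncomputable def digitGain : ℕ → (ℕ → Fin b) → (ℕ → Fin b) → ℝ
  | 0, _, _ => 1
  | k + 1, y, y' => haarKernel (k + 1) y y' / ((b : ℝ) ^ k * ((b : ℝ) - 1))

lemma digitKernel_eq (k : ℕ) (y y' : ℕ → Fin b) :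
    digitKernel k y y' = (b : ℝ) ^ k * if ∀ i < k, y i = y' i then 1 else 0 := by
  rw [digitKernel, Finset.prod_mul_distrib, Finset.prod_const, Finset.card_range,
    Finset.prod_ite_zero]
  simp

lemma digitKernel_eq_zero {k : ℕ} {y y' : ℕ → Fin b} (h : ¬ ∀ i < k, y i = y' i) :
    digitKernel k y y' = 0 := by
  rw [digitKernel_eq, if_neg h, mul_zero]

lemma digitKernel_nonneg (k : ℕ) (y y' : ℕ → Fin b) : 0 ≤ digitKernel k y y' := by
  rw [digitKernel_eq]; positivity

lemma digitKernel_comm (k : ℕ) (y y' : ℕ → Fin b) : digitKernel k y y' = digitKernel k y' y := by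
  simp only [digitKernel, eq_comm]

lemma haarKernel_comm (k : ℕ) (y y' : ℕ → Fin b) : haarKernel k y y' = haarKernel k y' y := by
  cases k with
  | zero => rfl
  | succ k => simp only [haarKernel, digitKernel_comm _ y y']

lemma haarKernel_eq_zero {k : ℕ} {y y' : ℕ → Fin b} (h : ¬ ∀ i < k - 1, y i = y' i) :
    haarKernel k y y' = 0 := by
  cases k with
  | zero => simp at h
  | succ k =>
    rw [Nat.add_sub_cancel] at h
    rw [haarKernel, digitKernel_eq_zero h, digitKernel_eq_zero, sub_zero]
    exact fun h' => h fun i hi => h' i (by omega)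

lemma upsilon_eq_digitGain [NeZero b] (hb : 2 ≤ b) {x x' : ℝ} (hx : x ∈ Set.Ico (0 : ℝ) 1)
    (hx' : x' ∈ Set.Ico (0 : ℝ) 1) (k : ℕ) :
    upsilon b k x x' = digitGain (k + 1) (Real.digits x b) (Real.digits x' b) := by
  have key : ∀ n : ℕ, ⌊(b : ℝ) ^ n * x⌋ = ⌊(b : ℝ) ^ n * x'⌋ ↔
      ∀ i < n, Real.digits x b i = Real.digits x' b i := fun n => by
    have h1 : (0 : ℝ) ≤ (b : ℝ) ^ n * x := mul_nonneg (by positivity) hx.1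
    have h2 : (0 : ℝ) ≤ (b : ℝ) ^ n * x' := mul_nonneg (by positivity) hx'.1
    rw [← natFloor_eq_iff_digits_eq hx hx', ← Int.natCast_floor_eq_floor h1,
      ← Int.natCast_floor_eq_floor h2, Nat.cast_inj]
  have hb0 : (b : ℝ) ≠ 0 := by positivity
  have hb1 : (b : ℝ) - 1 ≠ 0 := by
    have : (2 : ℝ) ≤ b := by exact_mod_cast hb
    linarith
  simp only [upsilon, digitGain, haarKernel, digitKernel_eq, key]
  field_simp
  ring

end digits

/-! ### Equidistribution of nets and vanishing gain coefficients -/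

section net

variable {b t m s : ℕ} {a : Fin (b ^ m) → Fin s → ℝ}

lemma mem_Ico_iff_natFloor_eq (hb : 2 ≤ b) {x : ℝ} (hx : 0 ≤ x) (k c : ℕ) :
    x ∈ Set.Ico ((c : ℝ) / (b : ℝ) ^ k) (((c : ℝ) + 1) / (b : ℝ) ^ k) ↔
      ⌊(b : ℝ) ^ k * x⌋₊ = c := by
  have hp : (0 : ℝ) < (b : ℝ) ^ k := by positivity
  rw [Nat.floor_eq_iff (by positivity), Set.mem_Ico, div_le_iff₀ hp, lt_div_iff₀ hp, mul_comm x]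

/-- A net puts the right number of points into every elementary box of volume at least
`b ^ (t - m)`, as such a box is a union of boxes of volume `b ^ (t - m)`. -/
lemma IsNet.card_box (hb : 2 ≤ b) (hs : 1 ≤ s) (ha : IsNet b t m a) {κ c : Fin s → ℕ}
    (hc : ∀ j, c j < b ^ κ j) (hκ : ∑ j, κ j ≤ m - t) :
    (Finset.univ.filter fun i => ∀ j, ⌊(b : ℝ) ^ κ j * a i j⌋₊ = c j).card =
      b ^ (m - ∑ j, κ j) := by
  obtain ⟨htm, ha01, hbox⟩ := ha
  have hb0 : (b : ℝ) ≠ 0 := by positivity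
  set j₀ : Fin s := ⟨0, hs⟩
  set r := m - t - ∑ j, κ j with hr
  have hbr : 0 < b ^ r := by positivity
  set κ' : Fin s → ℕ := Function.update κ j₀ (κ j₀ + r) with hκ'
  have hκ'sum : ∑ j, κ' j = m - t := by
    rw [hκ', Finset.sum_update_of_mem (Finset.mem_univ _), add_right_comm,
      ← Finset.erase_eq, Finset.add_sum_erase _ _ (Finset.mem_univ _)]
    omega
  have hdiv : ∀ i, ⌊(b : ℝ) ^ κ j₀ * a i j₀⌋₊ = ⌊(b : ℝ) ^ (κ j₀ + r) * a i j₀⌋₊ / b ^ r := by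
    intro i
    rw [← Nat.floor_div_natCast]
    congr 1
    push_cast
    rw [eq_div_iff (pow_ne_zero _ hb0), pow_add]
    ring
  rw [Finset.card_eq_sum_card_fiberwise (f := fun i => ⌊(b : ℝ) ^ (κ j₀ + r) * a i j₀⌋₊)
    (t := Finset.Ico (c j₀ * b ^ r) ((c j₀ + 1) * b ^ r))]
  · rw [Finset.sum_congr rfl (g := fun _ => b ^ t)]
    · rw [Finset.sum_const, Nat.card_Ico, smul_eq_mul, ← Nat.sub_mul, Nat.add_sub_cancel_left,
        one_mul, ← pow_add]
      congr 1; omega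
    · intro e he
      rw [Finset.mem_Ico] at he
      have hde : e / b ^ r = c j₀ :=
        Nat.div_eq_of_lt_le he.1 he.2
      have h1 := hbox κ' (Function.update c j₀ e) (fun j => ?_) hκ'sum
      · rw [← h1, ← Set.ncard_coe_finset]
        congr 1
        ext i
        simp only [Finset.coe_filter, Finset.mem_filter, Finset.mem_univ, true_and,
          Set.mem_ofPred_eq]
        have h2 : ∀ j, (a i j ∈ Set.Ico ((Function.update c j₀ e j : ℕ) / (b : ℝ) ^ κ' j)
            (((Function.update c j₀ e j : ℕ) + 1) / (b : ℝ) ^ κ' j)) ↔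
            ⌊(b : ℝ) ^ κ' j * a i j⌋₊ = Function.update c j₀ e j := fun j =>
          mem_Ico_iff_natFloor_eq hb (ha01 i j).1 _ _
        simp only [h2]
        constructor
        · rintro ⟨h3, h4⟩ j
          by_cases hj : j = j₀
          · subst hj; simpa [hκ'] using h4
          · simpa [hκ', Function.update_of_ne hj] using h3 j
        · intro h3
          have h4 : ⌊(b : ℝ) ^ (κ j₀ + r) * a i j₀⌋₊ = e := by simpa [hκ'] using h3 j₀
          refine ⟨fun j => ?_, h4⟩
          by_cases hj : j = j₀
          · subst hj; rw [hdiv, h4, hde]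
          · simpa [hκ', Function.update_of_ne hj] using h3 j
      · by_cases hj : j = j₀
        · subst hj
          simp only [hκ', Function.update_self]
          rw [pow_add]
          exact he.2.trans_le (Nat.mul_le_mul_right _ (hc j₀))
        · simpa [hκ', Function.update_of_ne hj] using hc j
  · intro i hi
    rw [Finset.mem_coe, Finset.mem_filter] at hi
    have h1 := hi.2 j₀
    rw [hdiv] at h1
    rw [Finset.mem_coe, Finset.mem_Ico, ← h1]
    exact ⟨Nat.div_mul_le_self _ _, by rw [mul_comm]; exact Nat.lt_mul_div_succ _ hbr⟩

lemma IsNet.mem_Ico (hb : 2 ≤ b) (hs : 1 ≤ s) (ha : IsNet b t m a) (i : Fin (b ^ m)) (j : Fin s) :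
    a i j ∈ Set.Ico (0 : ℝ) 1 := by
  have h1 := ha.card_box hb hs (κ := 0) (c := 0) (by simp) (by simp)
  have h2 : i ∈ Finset.univ.filter fun i => ∀ j, ⌊(b : ℝ) ^ (0 : Fin s → ℕ) j * a i j⌋₊ =
      (0 : Fin s → ℕ) j := by
    rw [Finset.eq_univ_of_card _ (h1.trans (by simp))]
    exact Finset.mem_univ i
  have h3 := (Finset.mem_filter.1 h2).2 j
  refine ⟨(ha.2.1 i j).1, ?_⟩
  simpa [Nat.floor_eq_zero] using h3

lemma IsNet.sum_prod_digitKernel [NeZero b] (hb : 2 ≤ b) (hs : 1 ≤ s) (ha : IsNet b t m a)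
    {κ : Fin s → ℕ} (hκ : ∑ j, κ j ≤ m - t) :
    ∑ i, ∑ i', ∏ j, digitKernel (κ j) (Real.digits (a i j) b) (Real.digits (a i' j) b) =
      (b : ℝ) ^ (2 * m) := by
  have h1 : ∀ i, ∑ i', ∏ j, digitKernel (κ j) (Real.digits (a i j) b) (Real.digits (a i' j) b) =
      (b : ℝ) ^ m := fun i => by
    have hlt : ∀ j, ⌊(b : ℝ) ^ κ j * a i j⌋₊ < b ^ κ j := fun j => by
      rw [Nat.floor_lt (mul_nonneg (by positivity) (ha.mem_Ico hb hs i j).1)]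
      push_cast
      exact mul_lt_of_lt_one_right (by positivity) (ha.mem_Ico hb hs i j).2
    have h2 := ha.card_box hb hs hlt hκ
    simp only [digitKernel_eq, Finset.prod_mul_distrib, Finset.prod_pow_eq_pow_sum,
      Finset.prod_ite_zero, Finset.prod_const_one]
    rw [← Finset.mul_sum, Finset.sum_boole]
    have h3 : (Finset.univ.filter fun i' => ∀ j ∈ Finset.univ, ∀ l < κ j,
        Real.digits (a i j) b l = Real.digits (a i' j) b l) =
        Finset.univ.filter fun i' => ∀ j, ⌊(b : ℝ) ^ κ j * a i' j⌋₊ = ⌊(b : ℝ) ^ κ j * a i j⌋₊ := by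
      refine Finset.filter_congr fun i' _ => ?_
      simp only [Finset.mem_univ, true_imp_iff]
      refine forall_congr' fun j => ?_
      rw [← natFloor_eq_iff_digits_eq (ha.mem_Ico hb hs i j) (ha.mem_Ico hb hs i' j), eq_comm]
    rw [h3, h2]
    push_cast
    rw [← pow_add]
    congr 1; omega
  simp only [h1, Finset.sum_const, Finset.card_univ, Fintype.card_fin, nsmul_eq_mul]
  push_cast
  rw [← pow_add]
  congr 1; ring

lemma digitGain_eq_mul_haarKernel (k : ℕ) :
    ∃ γ : ℝ, ∀ y y' : ℕ → Fin b, digitGain k y y' = γ * haarKernel k y y' := by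
  cases k with
  | zero => exact ⟨1, fun y y' => by simp [digitGain, haarKernel]⟩
  | succ k => exact ⟨((b : ℝ) ^ k * ((b : ℝ) - 1))⁻¹, fun y y' => by
      rw [digitGain, div_eq_inv_mul]⟩

/-- The low-order gain coefficients of a net vanish. -/
lemma IsNet.sum_prod_digitGain_eq_zero [NeZero b] (hb : 2 ≤ b) (hs : 1 ≤ s) (ha : IsNet b t m a)
    {κ : Fin s → ℕ} (hκ : ∑ j, κ j ≤ m - t) (hκ0 : κ ≠ 0) :
    ∑ i, ∑ i', ∏ j, digitGain (κ j) (Real.digits (a i j) b) (Real.digits (a i' j) b) = 0 := by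
  choose γ hγ using fun k => digitGain_eq_mul_haarKernel (b := b) k
  simp only [hγ, Finset.prod_mul_distrib, ← Finset.mul_sum]
  refine mul_eq_zero_of_right _ ?_
  set u : Finset (Fin s) := Finset.univ.filter fun j => κ j ≠ 0 with hu
  have h1 : ∀ y y' : Fin s → ℕ → Fin b, ∏ j, haarKernel (κ j) (y j) (y' j) =
      ∑ v ∈ u.powerset, (-1) ^ v.card *
        ∏ j, digitKernel (κ j - if j ∈ v then 1 else 0) (y j) (y' j) := by
    intro y y'
    have h2 : ∏ j, haarKernel (κ j) (y j) (y' j) =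
        ∏ j ∈ u, (digitKernel (κ j) (y j) (y' j) - digitKernel (κ j - 1) (y j) (y' j)) := by
      rw [hu, Finset.prod_filter]
      refine Finset.prod_congr rfl fun j _ => ?_
      rcases h : κ j with _ | k
      · simp [haarKernel]
      · simp [haarKernel]
    rw [h2]
    have h3 : ∀ v ∈ u.powerset, ∏ j, digitKernel (κ j - if j ∈ v then 1 else 0) (y j) (y' j) =
        (∏ j ∈ u \ v, digitKernel (κ j) (y j) (y' j)) *
          ∏ j ∈ v, digitKernel (κ j - 1) (y j) (y' j) := by
      intro v hv
      have hvu := Finset.mem_powerset.1 hv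
      have h4 : ∏ j ∈ u, digitKernel (κ j - if j ∈ v then 1 else 0) (y j) (y' j) =
          ∏ j, digitKernel (κ j - if j ∈ v then 1 else 0) (y j) (y' j) := by
        refine Finset.prod_subset (Finset.subset_univ _) fun j _ hj => ?_
        have : κ j = 0 := by simpa [hu] using hj
        simp [this, digitKernel]
      rw [← h4, ← Finset.prod_sdiff hvu]
      congr 1
      · refine Finset.prod_congr rfl fun j hj => ?_
        rw [if_neg (Finset.mem_sdiff.1 hj).2, Nat.sub_zero]
      · refine Finset.prod_congr rfl fun j hj => ?_
        rw [if_pos hj]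
    rw [Finset.sum_congr rfl fun v hv => by rw [h3 v hv]]
    rw [Finset.prod_sub]
    refine Finset.sum_congr rfl fun v _ => ?_
    ring
  have hsub : ∀ v ∈ u.powerset, ∑ j, (κ j - if j ∈ v then 1 else 0) ≤ m - t := fun v _ =>
    (Finset.sum_le_sum fun j _ => Nat.sub_le _ _).trans hκ
  calc _ = ∑ v ∈ u.powerset, (-1) ^ v.card * ∑ i, ∑ i', ∏ j,
        digitKernel (κ j - if j ∈ v then 1 else 0) (Real.digits (a i j) b)
          (Real.digits (a i' j) b) := by
        simp only [h1, Finset.mul_sum]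
        rw [Finset.sum_congr rfl fun i _ => Finset.sum_comm, Finset.sum_comm]
    _ = ∑ v ∈ u.powerset, (-1) ^ v.card * (b : ℝ) ^ (2 * m) :=
        Finset.sum_congr rfl fun v hv => by rw [ha.sum_prod_digitKernel hb hs (hsub v hv)]
    _ = 0 := by
        rw [← Finset.sum_mul]
        have hne : u.Nonempty := by
          obtain ⟨j, hj⟩ := Function.ne_iff.1 hκ0
          exact ⟨j, by simpa [hu] using hj⟩
        have := Finset.sum_powerset_neg_one_pow_card_of_nonempty hne
        rw [show ∑ v ∈ u.powerset, (-1 : ℝ) ^ v.card = 0 by exact_mod_cast this, zero_mul]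

end net

/-! ### The joint law of two scrambled points -/

section law

variable {b s : ℕ}

/-- The digits of the scramble by the permutations `σ` of the point with digits `y`. -/
def scrambleDigits (σ : List (Fin b) → Equiv.Perm (Fin b)) (y : ℕ → Fin b) : ℕ → Fin b :=
  fun k => σ (List.ofFn fun i : Fin k => y i) (y k)

lemma nestedScramble_eq_ofDigits [NeZero b] (σ : List (Fin b) → Equiv.Perm (Fin b)) (x : ℝ) :
    nestedScramble b σ x = Real.ofDigits (scrambleDigits σ (Real.digits x b)) := rfl

lemma card_perm_apply_eq (x z : Fin b) :
    b * (Finset.univ.filter fun σ : Equiv.Perm (Fin b) => σ x = z).card = b.factorial := by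
  have h1 : ∀ z' : Fin b, (Finset.univ.filter fun σ : Equiv.Perm (Fin b) => σ x = z').card =
      (Finset.univ.filter fun σ : Equiv.Perm (Fin b) => σ x = z).card := fun z' => by
    refine Finset.card_equiv (Equiv.mulLeft (Equiv.swap z' z)) fun σ => ?_
    simp only [Finset.mem_filter, Finset.mem_univ, true_and, Equiv.coe_mulLeft,
      Equiv.Perm.mul_apply]
    rw [Equiv.swap_apply_eq_iff, Equiv.swap_apply_right]
  have h2 := Finset.card_eq_sum_card_fiberwise (s := (Finset.univ : Finset (Equiv.Perm (Fin b))))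
    (t := Finset.univ) (f := fun σ => σ x) (by simp)
  simp only [h1] at h2
  rw [Finset.card_univ, Fintype.card_perm, Fintype.card_fin] at h2
  simpa using h2.symm

lemma card_perm_apply_eq_apply_eq {x x' z z' : Fin b} (hx : x ≠ x') (hz : z ≠ z') :
    (b - 1) * (Finset.univ.filter fun σ : Equiv.Perm (Fin b) => σ x = z ∧ σ x' = z').card =
      (Finset.univ.filter fun σ : Equiv.Perm (Fin b) => σ x = z).card := by
  have h1 : ∀ y ∈ Finset.univ.erase z,
      ((Finset.univ.filter fun σ : Equiv.Perm (Fin b) => σ x = z).filter fun σ => σ x' = y).card =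
      (Finset.univ.filter fun σ : Equiv.Perm (Fin b) => σ x = z ∧ σ x' = z').card := fun y hy => by
    have hyz := Finset.ne_of_mem_erase hy
    refine Finset.card_equiv (Equiv.mulLeft (Equiv.swap y z')) fun σ => ?_
    simp only [Finset.mem_filter, Finset.mem_univ, true_and, Equiv.coe_mulLeft,
      Equiv.Perm.mul_apply]
    rw [Equiv.swap_apply_eq_iff, Equiv.swap_apply_eq_iff, Equiv.swap_apply_right,
      Equiv.swap_apply_of_ne_of_ne hyz.symm hz]
  have h2 := Finset.card_eq_sum_card_fiberwise
    (s := Finset.univ.filter fun σ : Equiv.Perm (Fin b) => σ x = z)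
    (t := Finset.univ.erase z) (f := fun σ => σ x') (fun σ hσ => by
      have h3 : σ x = z := by simpa using hσ
      have h4 : σ x' ≠ z := fun h => hx (σ.injective (h3.trans h.symm))
      simpa using h4)
  rw [h2, Finset.sum_congr rfl h1]
  simp

variable {Ω : Type*} [MeasurableSpace Ω] {P : Measure Ω} [IsProbabilityMeasure P]
  {π : Fin s × List (Fin b) → Ω → Equiv.Perm (Fin b)}

lemma IsUniformPermFamily.measureReal_eq (hπ : IsUniformPermFamily b s P π)
    (q : Fin s × List (Fin b)) (A : Finset (Equiv.Perm (Fin b))) :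
    P.real (π q ⁻¹' A) = (A.card : ℝ) / b.factorial := by
  have h1 : ∀ σ, P.real (π q ⁻¹' {σ}) = (b.factorial : ℝ)⁻¹ := fun σ => by
    have h := hπ.2.2 q σ
    change P (π q ⁻¹' {σ}) = _ at h
    rw [Measure.real, h]
    simp
  have h2 := sum_measureReal_preimage_singleton (μ := P) A (f := π q)
    (fun σ _ => hπ.1 q (MeasurableSet.of_discrete (s := {σ})))
  rw [← h2]
  simp [h1, div_eq_mul_inv]

/-- The probability that digit `k` of the scrambles of the points with digits `y` and `y'` comes
out as digit `k` of `z` and `z'`, given that all the previous digits do. -/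
noncomputable def digitProb (k : ℕ) (y y' z z' : ℕ → Fin b) : ℝ :=
  if ∀ i < k + 1, y i = y' i then (if z k = z' k then 1 / (b : ℝ) else 0)
  else if ∀ i < k, y i = y' i then (if z k = z' k then 0 else 1 / ((b : ℝ) * ((b : ℝ) - 1)))
  else 1 / (b : ℝ) ^ 2

/-- The permutations indexed by the prefixes of length `k` that are compatible with digit `k` of the
scrambles. -/
def digitEvent (y y' z z' : ℕ → Fin b) (q : Σ k : ℕ, Fin k → Fin b) :
    Finset (Equiv.Perm (Fin b)) :=
  Finset.univ.filter fun σ => ((q.2 = fun i : Fin q.1 => y i) → σ (y q.1) = z q.1) ∧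
    ((q.2 = fun i : Fin q.1 => y' i) → σ (y' q.1) = z' q.1)

lemma prod_digitEvent (hb : 2 ≤ b) (k : ℕ) (y y' z z' : ℕ → Fin b) :
    ∏ w : Fin k → Fin b, ((digitEvent y y' z z' ⟨k, w⟩).card : ℝ) / b.factorial =
      digitProb k y y' z z' := by
  have hb0 : (b : ℝ) ≠ 0 := by positivity
  have hb1 : (b : ℝ) - 1 ≠ 0 := by
    have : (2 : ℝ) ≤ b := by exact_mod_cast hb
    linarith
  have hf0 : (b.factorial : ℝ) ≠ 0 := by positivity
  have hone : ∀ x v : Fin b, ((Finset.univ.filter fun σ : Equiv.Perm (Fin b) => σ x = v).card : ℝ) /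
      b.factorial = 1 / b := fun x v => by
    have : (b : ℝ) * ((Finset.univ.filter fun σ : Equiv.Perm (Fin b) => σ x = v).card : ℝ) =
      b.factorial := by exact_mod_cast card_perm_apply_eq x v
    rw [← this] at hf0 ⊢
    have := right_ne_zero_of_mul hf0
    field_simp
  have hpre : ((fun i : Fin k => y i) = fun i : Fin k => y' i) ↔ ∀ i < k, y i = y' i :=
    ⟨fun h i hi => congrFun h ⟨i, hi⟩, fun h => funext fun i => h i i.2⟩
  have hnone : ∀ w : Fin k → Fin b, w ≠ (fun i : Fin k => y i) → w ≠ (fun i : Fin k => y' i) →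
      ((digitEvent y y' z z' ⟨k, w⟩).card : ℝ) / b.factorial = 1 := fun w h1 h2 => by
    simp [digitEvent, h1, h2, Finset.card_univ, Fintype.card_perm, hf0]
  by_cases hk : ∀ i < k, y i = y' i
  · have hw := hpre.2 hk
    rw [Fintype.prod_eq_single (fun i : Fin k => y i) fun w h => hnone w h (hw ▸ h)]
    by_cases hk1 : y k = y' k
    · have h1 : ∀ i < k + 1, y i = y' i := fun i hi => by
        rcases Nat.lt_succ_iff_lt_or_eq.1 hi with h | rfl
        · exact hk i h
        · exact hk1
      rw [digitProb, if_pos h1]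
      by_cases hz : z k = z' k
      · rw [if_pos hz, ← hone (y k) (z k)]
        simp [digitEvent, ← hw, ← hk1, ← hz]
      · rw [if_neg hz, digitEvent, Finset.filter_eq_empty_iff.2]
        · simp
        · rintro σ - ⟨h2, h3⟩
          exact hz ((h2 rfl).symm.trans ((congrArg σ hk1).trans (h3 hw)))
    · have h1 : ¬ ∀ i < k + 1, y i = y' i := fun h => hk1 (h k (by omega))
      rw [digitProb, if_neg h1, if_pos hk]
      by_cases hz : z k = z' k
      · rw [if_pos hz, digitEvent, Finset.filter_eq_empty_iff.2]
        · simp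
        · rintro σ - ⟨h2, h3⟩
          exact hk1 (σ.injective ((h2 rfl).trans (hz.trans (h3 hw).symm)))
      · rw [if_neg hz]
        have h4 := card_perm_apply_eq_apply_eq hk1 hz
        have h5 : ((b : ℝ) - 1) * ((Finset.univ.filter fun σ : Equiv.Perm (Fin b) =>
            σ (y k) = z k ∧ σ (y' k) = z' k).card : ℝ) =
            ((Finset.univ.filter fun σ : Equiv.Perm (Fin b) => σ (y k) = z k).card : ℝ) := by
          rw [← h4]; push_cast [Nat.cast_sub (by omega : 1 ≤ b)]; ring
        have h6 := hone (y k) (z k)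
        rw [← h5, div_eq_div_iff hf0 hb0] at h6
        rw [div_eq_div_iff hf0 (mul_ne_zero hb0 hb1), one_mul]
        simp only [digitEvent, ← hw, true_imp_iff]
        linarith
  · have h1 : ¬ ∀ i < k + 1, y i = y' i := fun h => hk fun i hi => h i (by omega)
    have hne : (fun i : Fin k => y i) ≠ fun i : Fin k => y' i := fun h => hk (hpre.1 h)
    rw [digitProb, if_neg h1, if_neg hk, Fintype.prod_eq_mul _ _ hne fun w h => hnone w h.1 h.2]
    have e1 : digitEvent y y' z z' ⟨k, fun i : Fin k => y i⟩ =
        Finset.univ.filter fun σ : Equiv.Perm (Fin b) => σ (y k) = z k := by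
      simp [digitEvent, hne]
    have e2 : digitEvent y y' z z' ⟨k, fun i : Fin k => y' i⟩ =
        Finset.univ.filter fun σ : Equiv.Perm (Fin b) => σ (y' k) = z' k := by
      simp [digitEvent, hne.symm]
    rw [e1, e2, hone, hone]
    field_simp

/-- The events that the first `K` scrambled digits of two points take given values are
intersections of independent events, one for each coordinate and prefix. -/
lemma IsUniformPermFamily.measureReal_scrambleDigits (hb : 2 ≤ b)
    (hπ : IsUniformPermFamily b s P π) (K : ℕ) (y y' z z' : Fin s → ℕ → Fin b) :
    P.real {ω | ∀ j, ∀ k < K, scrambleDigits (fun w => π (j, w) ω) (y j) k = z j k ∧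
      scrambleDigits (fun w => π (j, w) ω) (y' j) k = z' j k} =
      ∏ j, ∏ k ∈ Finset.range K, digitProb k (y j) (y' j) (z j) (z' j) := by
  set g : Fin s × (Σ k : ℕ, Fin k → Fin b) → Fin s × List (Fin b) :=
    fun q => (q.1, List.ofFn q.2.2) with hg
  have hginj : Function.Injective g := by
    rintro ⟨j, k, w⟩ ⟨j', k', w'⟩ h
    simp only [hg, Prod.mk.injEq, List.ofFn_inj'] at h
    exact Prod.ext h.1 h.2
  set S : Finset (Fin s × (Σ k : ℕ, Fin k → Fin b)) :=
    Finset.univ ×ˢ ((Finset.range K).sigma fun _ => Finset.univ) with hS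
  have hind := (hπ.2.1.precomp hginj).measure_inter_preimage_eq_mul S
    (sets := fun q => digitEvent (y q.1) (y' q.1) (z q.1) (z' q.1) q.2)
    (fun q _ => MeasurableSet.of_discrete)
  have hset : {ω | ∀ j, ∀ k < K, scrambleDigits (fun w => π (j, w) ω) (y j) k = z j k ∧
      scrambleDigits (fun w => π (j, w) ω) (y' j) k = z' j k} =
      ⋂ q ∈ S, π (g q) ⁻¹' (digitEvent (y q.1) (y' q.1) (z q.1) (z' q.1) q.2) := by
    ext ω
    simp only [Set.mem_ofPred_eq, Set.mem_iInter, Set.mem_preimage, Finset.mem_coe, digitEvent,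
      Finset.mem_filter, Finset.mem_univ, true_and, scrambleDigits, hS, Finset.mem_product,
      Finset.mem_sigma, Finset.mem_range, and_true, hg]
    constructor
    · rintro h ⟨j, k, w⟩ hk
      refine ⟨fun hw => ?_, fun hw => ?_⟩
      · simp only at hw; subst hw; exact (h j k hk).1
      · simp only at hw; subst hw; exact (h j k hk).2
    · intro h j k hk
      exact ⟨(h (j, ⟨k, fun i => y j i⟩) hk).1 rfl, (h (j, ⟨k, fun i => y' j i⟩) hk).2 rfl⟩
  rw [hset, Measure.real, hind, ENNReal.toReal_prod]
  have hfac : ∀ q, (P (π (g q) ⁻¹' (digitEvent (y q.1) (y' q.1) (z q.1) (z' q.1) q.2))).toReal =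
      ((digitEvent (y q.1) (y' q.1) (z q.1) (z' q.1) q.2).card : ℝ) / b.factorial :=
    fun q => hπ.measureReal_eq (g q) _
  rw [Finset.prod_congr rfl fun q _ => hfac q, hS, Finset.prod_product]
  refine Finset.prod_congr rfl fun j _ => ?_
  rw [Finset.prod_sigma]
  exact Finset.prod_congr rfl fun k _ => prod_digitEvent hb k (y j) (y' j) (z j) (z' j)

/-- The joint law of the digits of two scrambled points, in one coordinate, is diagonal in the
Haar kernels, with the gain factors as eigenvalues. -/
lemma prod_digitProb (hb : 2 ≤ b) (K : ℕ) (y y' z z' : ℕ → Fin b) :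
    (b : ℝ) ^ (2 * K) * ∏ k ∈ Finset.range K, digitProb k y y' z z' =
      ∑ k ∈ Finset.range (K + 1), digitGain k y y' * haarKernel k z z' := by
  have hb0 : (b : ℝ) ≠ 0 := by positivity
  have hb1 : (b : ℝ) - 1 ≠ 0 := by
    have : (2 : ℝ) ≤ b := by exact_mod_cast hb
    linarith
  -- as long as `y` and `y'` agree the sum telescopes
  suffices h : (b : ℝ) ^ (2 * K) * ∏ k ∈ Finset.range K, digitProb k y y' z z' =
      ∑ k ∈ Finset.range (K + 1), digitGain k y y' * haarKernel k z z' ∧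
      ((∀ i < K, y i = y' i) → ∑ k ∈ Finset.range (K + 1), digitGain k y y' * haarKernel k z z' =
        digitKernel K z z') from h.1
  induction K with
  | zero => simp [digitGain, haarKernel, digitKernel]
  | succ K ih =>
    obtain ⟨ih1, ih2⟩ := ih
    have hstep : (b : ℝ) ^ (2 * (K + 1)) * ∏ k ∈ Finset.range (K + 1), digitProb k y y' z z' =
        (b : ℝ) ^ 2 * digitProb K y y' z z' *
          ∑ k ∈ Finset.range (K + 1), digitGain k y y' * haarKernel k z z' := by
      rw [Finset.prod_range_succ, ← ih1]; ring
    have hkz : digitKernel (K + 1) z z' =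
        digitKernel K z z' * ((b : ℝ) * if z K = z' K then 1 else 0) := by
      rw [digitKernel, Finset.prod_range_succ, digitKernel]
    rw [hstep, Finset.sum_range_succ _ (K + 1)]
    by_cases h1 : ∀ i < K + 1, y i = y' i
    · have h0 : ∀ i < K, y i = y' i := fun i hi => h1 i (by omega)
      have hγ : digitGain (K + 1) y y' = 1 := by
        simp only [digitGain, haarKernel, digitKernel_eq, if_pos h1, if_pos h0]
        field_simp
        ring
      rw [ih2 h0, hγ, one_mul, haarKernel, digitProb, if_pos h1]
      refine ⟨?_, fun _ => by ring⟩
      rw [hkz]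
      split_ifs <;> field_simp <;> ring
    · refine ⟨?_, fun h => absurd h h1⟩
      by_cases h0 : ∀ i < K, y i = y' i
      · have hγ : digitGain (K + 1) y y' = -1 / ((b : ℝ) - 1) := by
          simp only [digitGain, haarKernel, digitKernel_eq, if_neg h1, if_pos h0]
          field_simp
          ring
        rw [ih2 h0, hγ, haarKernel, digitProb, if_neg h1, if_pos h0, hkz]
        split_ifs <;> field_simp <;> ring
      · have hγ : digitGain (K + 1) y y' = 0 := by
          simp only [digitGain, haarKernel, digitKernel_eq, if_neg h1, if_neg h0]
          simp
        rw [hγ, digitProb, if_neg h1, if_neg h0, zero_mul, add_zero]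
        field_simp

/-- Almost surely the scrambled digits do not end in digits `b - 1`. -/
lemma IsUniformPermFamily.ae_exists_ne_last (hb : 2 ≤ b) (hπ : IsUniformPermFamily b s P π)
    (y : ℕ → Fin b) (j : Fin s) :
    ∀ᵐ ω ∂P, ∀ k₀, ∃ k ≥ k₀, (scrambleDigits (fun w => π (j, w) ω) y k : ℕ) ≠ b - 1 := by
  refine ae_all_iff.2 fun k₀ => ?_
  set a : Fin b := ⟨b - 1, by omega⟩
  set g : ℕ → Fin s × List (Fin b) := fun k => (j, List.ofFn fun i : Fin k => y i) with hg
  have hginj : Function.Injective g := fun k k' h => by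
    simpa [hg] using congrArg (fun q => q.2.length) h
  rw [ae_iff]
  have hle : ∀ L : ℕ, P.real {ω | ¬ ∃ k ≥ k₀,
      (scrambleDigits (fun w => π (j, w) ω) y k : ℕ) ≠ b - 1} ≤ ((b : ℝ)⁻¹) ^ L := fun L => by
    have hind := (hπ.2.1.precomp hginj).measure_inter_preimage_eq_mul (Finset.Ico k₀ (k₀ + L))
      (sets := fun k => (Finset.univ.filter fun σ : Equiv.Perm (Fin b) => σ (y k) = a))
      (fun q _ => MeasurableSet.of_discrete)
    have h1 : P.real (⋂ k ∈ Finset.Ico k₀ (k₀ + L), π (g k) ⁻¹'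
        (Finset.univ.filter fun σ : Equiv.Perm (Fin b) => σ (y k) = a)) = ((b : ℝ)⁻¹) ^ L := by
      rw [Measure.real]
      refine (congrArg ENNReal.toReal hind).trans ?_
      rw [ENNReal.toReal_prod]
      have h2 : ∀ k, (P (π (g k) ⁻¹'
          (Finset.univ.filter fun σ : Equiv.Perm (Fin b) => σ (y k) = a))).toReal = (b : ℝ)⁻¹ :=
        fun k => by
          refine (hπ.measureReal_eq (g k) _).trans ?_
          have h3 : (b : ℝ) * ((Finset.univ.filter fun σ : Equiv.Perm (Fin b) =>
            σ (y k) = a).card : ℝ) = b.factorial := by exact_mod_cast card_perm_apply_eq (y k) a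
          have hf0 : (b.factorial : ℝ) ≠ 0 := by positivity
          rw [← h3] at hf0 ⊢
          have := right_ne_zero_of_mul hf0
          field_simp
      exact (Finset.prod_congr rfl fun k _ => h2 k).trans (by simp)
    rw [← h1]
    refine measureReal_mono fun ω hω => ?_
    simp only [Set.mem_ofPred_eq, not_exists, not_and, not_not] at hω
    simp only [Set.mem_iInter, Set.mem_preimage, Finset.mem_coe, Finset.mem_filter,
      Finset.mem_univ, true_and]
    intro k hk
    exact Fin.ext (hω k (Finset.mem_Ico.1 hk).1)
  have hb1 : ((b : ℝ)⁻¹) < 1 := inv_lt_one_of_one_lt₀ (by exact_mod_cast hb)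
  have h0 := ge_of_tendsto' (tendsto_pow_atTop_nhds_zero_of_lt_one (by positivity) hb1) hle
  exact (measureReal_eq_zero_iff).1 (le_antisymm h0 measureReal_nonneg)

end law

/-! ### Haar analysis on finite digit strings -/

section haar

variable {b s K : ℕ} [NeZero b]

/-- The digit sequence that starts with the string `z` and continues with zeros. -/
def zeroExt (z : Fin K → Fin b) : ℕ → Fin b := fun k => if h : k < K then z ⟨k, h⟩ else 0

lemma zeroExt_apply (z : Fin K → Fin b) {k : ℕ} (h : k < K) : zeroExt z k = z ⟨k, h⟩ := by
  simp [zeroExt, h]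

lemma digitKernel_zeroExt {k : ℕ} (hk : k ≤ K) (z z' : Fin K → Fin b) :
    digitKernel k (zeroExt z) (zeroExt z') =
      ∏ i : Fin K, if (i : ℕ) < k then (b : ℝ) * (if z i = z' i then 1 else 0) else 1 := by
  have h1 : digitKernel k (zeroExt z) (zeroExt z') = ∏ i ∈ Finset.range K,
      if i < k then (b : ℝ) * (if zeroExt z i = zeroExt z' i then 1 else 0) else 1 := by
    rw [digitKernel, ← Finset.prod_filter]
    congr 1
    ext i
    simp only [Finset.mem_range, Finset.mem_filter]
    omega
  rw [h1, Finset.prod_range]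
  refine Finset.prod_congr rfl fun i _ => ?_
  rw [zeroExt_apply z i.2, zeroExt_apply z' i.2]

lemma sum_digitKernel_mul_digitKernel {k l : ℕ} (hk : k ≤ K) (hl : l ≤ K) (u z : Fin K → Fin b) :
    ∑ v : Fin K → Fin b, digitKernel k (zeroExt u) (zeroExt v) *
      digitKernel l (zeroExt v) (zeroExt z) =
      (b : ℝ) ^ K * digitKernel (min k l) (zeroExt u) (zeroExt z) := by
  simp only [digitKernel_zeroExt hk, digitKernel_zeroExt hl,
    digitKernel_zeroExt (le_trans (min_le_left k l) hk), ← Finset.prod_mul_distrib]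
  have h1 := Fintype.prod_sum (fun (i : Fin K) (c : Fin b) =>
    (if (i : ℕ) < k then (b : ℝ) * (if u i = c then 1 else 0) else 1) *
      (if (i : ℕ) < l then (b : ℝ) * (if c = z i then 1 else 0) else 1))
  have h2 : (b : ℝ) ^ K = ∏ _i : Fin K, (b : ℝ) := by simp
  rw [← h1, h2, ← Finset.prod_mul_distrib]
  refine Finset.prod_congr rfl fun i _ => ?_
  by_cases h3 : (i : ℕ) < k <;> by_cases h4 : (i : ℕ) < l <;>
    simp [h3, h4]

lemma sum_haarKernel_mul_haarKernel {k : ℕ} (hk : k ≤ K) (u z : Fin K → Fin b) :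
    ∑ v : Fin K → Fin b, haarKernel k (zeroExt u) (zeroExt v) *
      haarKernel k (zeroExt v) (zeroExt z) =
      (b : ℝ) ^ K * haarKernel k (zeroExt u) (zeroExt z) := by
  cases k with
  | zero => simp [haarKernel, Finset.card_univ]
  | succ k =>
    simp only [haarKernel, sub_mul, mul_sub, Finset.sum_sub_distrib]
    rw [sum_digitKernel_mul_digitKernel hk hk, sum_digitKernel_mul_digitKernel hk (by omega),
      sum_digitKernel_mul_digitKernel (by omega) hk,
      sum_digitKernel_mul_digitKernel (by omega) (by omega)]
    simp

lemma sum_digitKernel {k : ℕ} (hk : k ≤ K) (u : Fin K → Fin b) :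
    ∑ v : Fin K → Fin b, digitKernel k (zeroExt u) (zeroExt v) = (b : ℝ) ^ K := by
  have := sum_digitKernel_mul_digitKernel hk (Nat.zero_le K) u u
  simpa [digitKernel] using this

lemma sum_haarKernel_eq_zero {k : ℕ} (hk : k ≤ K) (hk0 : k ≠ 0) (u : Fin K → Fin b) :
    ∑ v : Fin K → Fin b, haarKernel k (zeroExt u) (zeroExt v) = 0 := by
  obtain ⟨k, rfl⟩ := Nat.exists_eq_succ_of_ne_zero hk0
  simp only [haarKernel, Finset.sum_sub_distrib]
  rw [sum_digitKernel hk, sum_digitKernel (by omega), sub_self]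

lemma sum_abs_haarKernel_le {k : ℕ} (hk : k ≤ K) (u : Fin K → Fin b) :
    ∑ v : Fin K → Fin b, |haarKernel k (zeroExt u) (zeroExt v)| ≤ 2 * (b : ℝ) ^ K := by
  cases k with
  | zero =>
    have : (0 : ℝ) ≤ (b : ℝ) ^ K := by positivity
    simp [haarKernel, Finset.card_univ]
    linarith
  | succ k =>
    calc _ ≤ ∑ v : Fin K → Fin b, (digitKernel (k + 1) (zeroExt u) (zeroExt v) +
          digitKernel k (zeroExt u) (zeroExt v)) := Finset.sum_le_sum fun v _ => by
          refine (abs_sub _ _).trans ?_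
          rw [abs_of_nonneg (digitKernel_nonneg _ _ _), abs_of_nonneg (digitKernel_nonneg _ _ _)]
      _ = _ := by
          rw [Finset.sum_add_distrib, sum_digitKernel hk, sum_digitKernel (by omega)]; ring

/-- The component of `F` of order `κ j` in coordinate `j`, up to normalization. -/
def haarProj (κ : Fin s → ℕ) (F : (Fin s → Fin K → Fin b) → ℝ) (u : Fin s → Fin K → Fin b) : ℝ :=
  ∑ z, (∏ j, haarKernel (κ j) (zeroExt (u j)) (zeroExt (z j))) * F z

/-- The quadratic form of the projection onto the component of order `κ`, up to normalization. -/
def haarForm (κ : Fin s → ℕ) (F : (Fin s → Fin K → Fin b) → ℝ) : ℝ :=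
  ∑ z, ∑ z', F z * F z' * ∏ j, haarKernel (κ j) (zeroExt (z j)) (zeroExt (z' j))

lemma pow_mul_haarForm {κ : Fin s → ℕ} (hκ : ∀ j, κ j ≤ K) (F : (Fin s → Fin K → Fin b) → ℝ) :
    (b : ℝ) ^ (K * s) * haarForm κ F = ∑ u, haarProj κ F u ^ 2 := by
  have h1 : ∀ z z' : Fin s → Fin K → Fin b,
      ∑ u : Fin s → Fin K → Fin b, (∏ j, haarKernel (κ j) (zeroExt (u j)) (zeroExt (z j))) *
        ∏ j, haarKernel (κ j) (zeroExt (u j)) (zeroExt (z' j)) =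
      (b : ℝ) ^ (K * s) * ∏ j, haarKernel (κ j) (zeroExt (z j)) (zeroExt (z' j)) := by
    intro z z'
    have h2 := Fintype.prod_sum (fun (j : Fin s) (v : Fin K → Fin b) =>
       haarKernel (κ j) (zeroExt (z j)) (zeroExt v) *
        haarKernel (κ j) (zeroExt v) (zeroExt (z' j)))
    simp only [← Finset.prod_mul_distrib]
    rw [Finset.sum_congr rfl fun u _ => Finset.prod_congr rfl fun j _ => by
      rw [haarKernel_comm (κ j) (zeroExt (u j)) (zeroExt (z j))], ← h2,
      Finset.prod_congr rfl fun j _ => sum_haarKernel_mul_haarKernel (hκ j) (z j) (z' j),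
      Finset.prod_mul_distrib]
    simp [pow_mul]
  have h2 : ∀ u, haarProj κ F u ^ 2 = ∑ z, ∑ z', F z * F z' *
      ((∏ j, haarKernel (κ j) (zeroExt (u j)) (zeroExt (z j))) *
        ∏ j, haarKernel (κ j) (zeroExt (u j)) (zeroExt (z' j))) := fun u => by
    rw [haarProj, sq, Finset.sum_mul_sum]
    refine Finset.sum_congr rfl fun z _ => Finset.sum_congr rfl fun z' _ => ?_
    ring
  simp only [h2]
  rw [Finset.sum_comm, haarForm, Finset.mul_sum]
  refine Finset.sum_congr rfl fun z _ => ?_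
  rw [Finset.sum_comm, Finset.mul_sum]
  refine Finset.sum_congr rfl fun z' _ => ?_
  rw [← Finset.mul_sum, h1]
  ring

lemma sum_mul_eq_zero_of_update {ι A : Type*} [Fintype ι] [DecidableEq ι] [Fintype A] (j : ι)
    {g : A → ℝ} (hg : ∑ a, g a = 0) {H : (ι → A) → ℝ}
    (hH : ∀ z a, H (Function.update z j a) = H z) : ∑ z : ι → A, g (z j) * H z = 0 := by
  rcases isEmpty_or_nonempty A with hA | ⟨⟨a₀⟩⟩
  · have : IsEmpty (ι → A) := ⟨fun z => hA.false (z j)⟩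
    simp
  rw [← Equiv.sum_comp (Equiv.funSplitAt j A).symm, Fintype.sum_prod_type_right]
  refine Finset.sum_eq_zero fun y _ => ?_
  have h1 : ∀ a, H ((Equiv.funSplitAt j A).symm (a, y)) =
      H ((Equiv.funSplitAt j A).symm (a₀, y)) := fun a => by
    rw [← hH _ a₀]
    congr 1
    ext i
    by_cases hi : i = j
    · subst hi; simp [Equiv.funSplitAt, Equiv.piSplitAt]
    · simp [Equiv.funSplitAt, Equiv.piSplitAt, hi]
  simp only [h1, ← Finset.sum_mul]
  rw [show ∑ a, g ((Equiv.funSplitAt j A).symm (a, y) j) = ∑ a, g a from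
    Finset.sum_congr rfl fun a _ => by simp [Equiv.funSplitAt, Equiv.piSplitAt], hg, zero_mul]

/-- As the kernels of positive order have mean zero, `F` may be replaced by its rectangular
differences with corner at the argument. -/
lemma haarProj_eq_sum_rdiff {κ : Fin s → ℕ} (hκ : ∀ j, κ j ≤ K)
    (F : (Fin s → Fin K → Fin b) → ℝ) (u : Fin s → Fin K → Fin b) :
    haarProj κ F u = ∑ z, (∏ j, haarKernel (κ j) (zeroExt (u j)) (zeroExt (z j))) *
      rdiff id (Finset.univ.filter fun j => κ j ≠ 0) F z u := by
  set w := Finset.univ.filter fun j => κ j ≠ 0 with hw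
  simp only [rdiff, Finset.mul_sum]
  rw [Finset.sum_comm, Finset.sum_eq_single ∅]
  · simp [mix_empty, haarProj]
  · intro V hV hV0
    obtain ⟨j, hj⟩ := Finset.nonempty_iff_ne_empty.2 hV0
    have hκj : κ j ≠ 0 := (Finset.mem_filter.1 (Finset.mem_powerset.1 hV hj)).2
    have h1 := sum_mul_eq_zero_of_update j (sum_haarKernel_eq_zero (hκ j) hκj (u j))
      (H := fun z => (∏ i ∈ Finset.univ.erase j,
        haarKernel (κ i) (zeroExt (u i)) (zeroExt (z i))) * ((-1) ^ V.card * F (mix id V z u)))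
      (fun z a => by
        congr 1
        · refine Finset.prod_congr rfl fun i hi => ?_
          rw [Function.update_of_ne (Finset.ne_of_mem_erase hi)]
        · congr 2
          ext1 i
          simp only [mix, id]
          split_ifs with hi
          · rfl
          · rw [Function.update_of_ne]
            rintro rfl
            exact hi hj)
    rw [← h1]
    refine Finset.sum_congr rfl fun z _ => ?_
    rw [← Finset.mul_prod_erase _ _ (Finset.mem_univ j)]
    ring
  · simp

lemma abs_haarProj_le {κ : Fin s → ℕ} (hκ : ∀ j, κ j ≤ K) (hκ0 : κ ≠ 0)
    {F : (Fin s → Fin K → Fin b) → ℝ} {C ρ : ℝ} (hC : 0 ≤ C) (hρ : 0 < ρ) (hρ1 : ρ ≤ 1)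
    (hF : ∀ w : Finset (Fin s), w.Nonempty → ∀ (z z' : Fin s → Fin K → Fin b) (k : Fin s → ℕ),
      (∀ j, ∀ i < k j, zeroExt (z j) i = zeroExt (z' j) i) →
      |rdiff id w F z z'| ≤ C * ∏ j ∈ w, ρ ^ k j) (u : Fin s → Fin K → Fin b) :
    |haarProj κ F u| ≤ (2 * (b : ℝ) ^ K) ^ s * (C * (ρ ^ (∑ j, κ j) / ρ ^ s)) := by
  set w := Finset.univ.filter fun j => κ j ≠ 0 with hw
  have hwne : w.Nonempty := by
    obtain ⟨j, hj⟩ := Function.ne_iff.1 hκ0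
    exact ⟨j, by simpa [hw] using hj⟩
  have hρw : ∏ j ∈ w, ρ ^ (κ j - 1) ≤ ρ ^ (∑ j, κ j) / ρ ^ s := by
    have h1 : ∏ j ∈ w, ρ ^ (κ j - 1) = ∏ j, ρ ^ (κ j - 1) := by
      refine Finset.prod_subset (Finset.subset_univ _) fun j _ hj => ?_
      have : κ j = 0 := by simpa [hw] using hj
      simp [this]
    have h2 : ρ ^ (∑ j, κ j) / ρ ^ s = ∏ j, ρ ^ κ j / ρ := by
      rw [Finset.prod_div_distrib, Finset.prod_pow_eq_pow_sum]; simp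
    rw [h1, h2]
    refine Finset.prod_le_prod (fun j _ => by positivity) fun j _ => ?_
    rw [le_div_iff₀ hρ, ← pow_succ]
    exact pow_le_pow_of_le_one hρ.le hρ1 (by omega)
  rw [haarProj_eq_sum_rdiff hκ, ← hw]
  have hterm : ∀ z : Fin s → Fin K → Fin b,
      |(∏ j, haarKernel (κ j) (zeroExt (u j)) (zeroExt (z j))) * rdiff id w F z u| ≤
      (∏ j, |haarKernel (κ j) (zeroExt (u j)) (zeroExt (z j))|) *
        (C * (ρ ^ (∑ j, κ j) / ρ ^ s)) := fun z => by
    rw [abs_mul, Finset.abs_prod]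
    by_cases h : ∀ j, ∀ i < κ j - 1, zeroExt (u j) i = zeroExt (z j) i
    · exact mul_le_mul_of_nonneg_left ((hF w hwne z u (fun j => κ j - 1)
        fun j i hi => (h j i hi).symm).trans (mul_le_mul_of_nonneg_left hρw hC))
        (Finset.prod_nonneg fun j _ => abs_nonneg _)
    · obtain ⟨j, hj⟩ := not_forall.1 h
      rw [Finset.prod_eq_zero (Finset.mem_univ j) (by rw [haarKernel_eq_zero hj, abs_zero])]
      simp
  refine (Finset.abs_sum_le_sum_abs _ _).trans ((Finset.sum_le_sum fun z _ => hterm z).trans ?_)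
  rw [← Finset.sum_mul]
  refine mul_le_mul_of_nonneg_right ?_ (by positivity)
  have h2 := Fintype.prod_sum (fun (j : Fin s) (v : Fin K → Fin b) =>
    |haarKernel (κ j) (zeroExt (u j)) (zeroExt v)|)
  rw [← h2]
  calc _ ≤ ∏ _j : Fin s, 2 * (b : ℝ) ^ K :=
        Finset.prod_le_prod (fun j _ => Finset.sum_nonneg fun v _ => abs_nonneg _)
          fun j _ => sum_abs_haarKernel_le (hκ j) (u j)
    _ = _ := by simp

/-- The variance component of order `κ` decays like `ρ ^ (2 |κ|)`. -/
lemma haarForm_mem_Icc {κ : Fin s → ℕ} (hκ : ∀ j, κ j ≤ K) (hκ0 : κ ≠ 0)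
    {F : (Fin s → Fin K → Fin b) → ℝ} {C ρ : ℝ} (hC : 0 ≤ C) (hρ : 0 < ρ) (hρ1 : ρ ≤ 1)
    (hF : ∀ w : Finset (Fin s), w.Nonempty → ∀ (z z' : Fin s → Fin K → Fin b) (k : Fin s → ℕ),
      (∀ j, ∀ i < k j, zeroExt (z j) i = zeroExt (z' j) i) →
      |rdiff id w F z z'| ≤ C * ∏ j ∈ w, ρ ^ k j) :
    haarForm κ F / ((b : ℝ) ^ (2 * K)) ^ s ∈
      Set.Icc 0 (4 ^ s * C ^ 2 / (ρ ^ 2) ^ s * (ρ ^ 2) ^ (∑ j, κ j)) := by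
  have hb : (0 : ℝ) < b := by exact_mod_cast NeZero.pos b
  have hB : (0 : ℝ) < (b : ℝ) ^ (K * s) := by positivity
  have h1 := pow_mul_haarForm hκ F
  have h2 : haarForm κ F = (∑ u, haarProj κ F u ^ 2) / (b : ℝ) ^ (K * s) := by
    rw [← h1]; field_simp
  have h3 : ∑ u, haarProj κ F u ^ 2 ≤
      (b : ℝ) ^ (K * s) * ((2 * (b : ℝ) ^ K) ^ s * (C * (ρ ^ (∑ j, κ j) / ρ ^ s))) ^ 2 := by
    have h4 : ∀ u, haarProj κ F u ^ 2 ≤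
        ((2 * (b : ℝ) ^ K) ^ s * (C * (ρ ^ (∑ j, κ j) / ρ ^ s))) ^ 2 := fun u => by
      have := abs_le.1 (abs_haarProj_le hκ hκ0 hC hρ hρ1 hF u)
      exact sq_le_sq' this.1 this.2
    refine (Finset.sum_le_card_nsmul _ _ _ fun u _ => h4 u).trans ?_
    simp [Finset.card_univ, pow_mul]
  constructor
  · rw [h2]
    exact div_nonneg (div_nonneg (Finset.sum_nonneg fun u _ => sq_nonneg _) hB.le) (by positivity)
  · rw [h2, div_div, div_le_iff₀ (by positivity)]
    refine h3.trans (le_of_eq ?_)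
    have e1 : (2 * (b : ℝ) ^ K) ^ s = 2 ^ s * (b : ℝ) ^ (K * s) := by rw [mul_pow, pow_mul]
    have e2 : (4 : ℝ) ^ s = (2 ^ s) ^ 2 := by rw [← pow_mul, mul_comm, pow_mul]; norm_num
    have e3 : ((b : ℝ) ^ (2 * K)) ^ s = ((b : ℝ) ^ (K * s)) ^ 2 := by ring
    rw [e1, e2, e3]
    have hρs : ρ ^ s ≠ 0 := by positivity
    field_simp
    ring

end haar

/-! ### The second moment of the scrambled estimate -/

section moment

variable {b s K : ℕ} {Ω : Type*} [MeasurableSpace Ω] {P : Measure Ω}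
  {π : Fin s × List (Fin b) → Ω → Equiv.Perm (Fin b)}

/-- The first `K` digits of the scramble of the point with digits `y j` in coordinate `j`. -/
def scrambledString (K : ℕ) (π : Fin s × List (Fin b) → Ω → Equiv.Perm (Fin b))
    (y : Fin s → ℕ → Fin b) (ω : Ω) : Fin s → Fin K → Fin b :=
  fun j k => scrambleDigits (fun w => π (j, w) ω) (y j) k

lemma IsUniformPermFamily.measurable_scrambledString (hπ : IsUniformPermFamily b s P π)
    (y : Fin s → ℕ → Fin b) : Measurable (scrambledString K π y) := by
  refine measurable_pi_iff.2 fun j => measurable_pi_iff.2 fun k => ?_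
  exact (Measurable.of_discrete (f := fun σ : Equiv.Perm (Fin b) => σ (y j k))).comp (hπ.1 _)

variable [NeZero b] [IsProbabilityMeasure P]

/-- The mixed second moment of the values at two scrambled points, in the Haar decomposition. -/
lemma IsUniformPermFamily.integral_mul (hb : 2 ≤ b) (hπ : IsUniformPermFamily b s P π)
    (F : (Fin s → Fin K → Fin b) → ℝ) (y y' : Fin s → ℕ → Fin b) :
    ∫ ω, F (scrambledString K π y ω) * F (scrambledString K π y' ω) ∂P =
      ∑ κ ∈ Fintype.piFinset fun _ : Fin s => Finset.range (K + 1),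
        haarForm κ F / ((b : ℝ) ^ (2 * K)) ^ s * ∏ j, digitGain (κ j) (y j) (y' j) := by
  have hb0 : (b : ℝ) ≠ 0 := by positivity
  set Z : Ω → (Fin s → Fin K → Fin b) × (Fin s → Fin K → Fin b) :=
    fun ω => (scrambledString K π y ω, scrambledString K π y' ω) with hZ
  have hZm : Measurable Z :=
    (hπ.measurable_scrambledString y).prodMk (hπ.measurable_scrambledString y')
  have h1 : ∫ ω, F (scrambledString K π y ω) * F (scrambledString K π y' ω) ∂P =
      ∑ z, ∑ z', P.real (Z ⁻¹' {(z, z')}) * (F z * F z') := by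
    have h2 := integral_map (μ := P) hZm.aemeasurable
      (f := fun p : (Fin s → Fin K → Fin b) × (Fin s → Fin K → Fin b) => F p.1 * F p.2)
      (Measurable.of_discrete).aestronglyMeasurable
    have hp : IsProbabilityMeasure (P.map Z) := Measure.isProbabilityMeasure_map hZm.aemeasurable
    rw [← h2, integral_fintype (Integrable.of_finite), Fintype.sum_prod_type]
    refine Finset.sum_congr rfl fun z _ => Finset.sum_congr rfl fun z' _ => ?_
    rw [map_measureReal_apply hZm (measurableSet_singleton _), smul_eq_mul]
  have h3 : ∀ z z' : Fin s → Fin K → Fin b, P.real (Z ⁻¹' {(z, z')}) =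
      (∑ κ ∈ Fintype.piFinset fun _ : Fin s => Finset.range (K + 1),
        ∏ j, (digitGain (κ j) (y j) (y' j) * haarKernel (κ j) (zeroExt (z j)) (zeroExt (z' j)))) /
        ((b : ℝ) ^ (2 * K)) ^ s := by
    intro z z'
    have h4 := hπ.measureReal_scrambleDigits hb K y y' (fun j => zeroExt (z j))
      (fun j => zeroExt (z' j))
    have h5 : Z ⁻¹' {(z, z')} = {ω | ∀ j, ∀ k < K,
        scrambleDigits (fun w => π (j, w) ω) (y j) k = zeroExt (z j) k ∧
        scrambleDigits (fun w => π (j, w) ω) (y' j) k = zeroExt (z' j) k} := by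
      ext ω
      simp only [Set.mem_preimage, Set.mem_singleton_iff, hZ, Prod.mk.injEq, Set.mem_ofPred_eq]
      constructor
      · rintro ⟨rfl, rfl⟩ j k hk
        simp only [zeroExt_apply _ hk]
        exact ⟨rfl, rfl⟩
      · intro h
        constructor
        · ext1 j; ext1 k
          have := (h j k k.2).1
          rwa [zeroExt_apply _ k.2] at this
        · ext1 j; ext1 k
          have := (h j k k.2).2
          rwa [zeroExt_apply _ k.2] at this
    have h6 := Finset.prod_univ_sum (fun _ : Fin s => Finset.range (K + 1)) fun j k =>
      digitGain k (y j) (y' j) * haarKernel k (zeroExt (z j)) (zeroExt (z' j))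
    rw [h5, h4, ← h6]
    rw [Finset.prod_congr rfl fun j _ => (prod_digitProb hb K (y j) (y' j) (zeroExt (z j))
      (zeroExt (z' j))).symm, Finset.prod_mul_distrib]
    simp only [Finset.prod_const, Finset.card_univ, Fintype.card_fin]
    field_simp
  rw [h1]
  simp only [h3, haarForm, Finset.prod_mul_distrib, Finset.sum_div, Finset.sum_mul]
  rw [Finset.sum_congr rfl fun z _ => Finset.sum_comm, Finset.sum_comm]
  refine Finset.sum_congr rfl fun κ _ => Finset.sum_congr rfl fun z _ =>
    Finset.sum_congr rfl fun z' _ => ?_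
  ring

end moment

section moment_bound

variable {b s t m K : ℕ} [NeZero b] {Ω : Type*} [MeasurableSpace Ω] {P : Measure Ω}
  [IsProbabilityMeasure P] {π : Fin s × List (Fin b) → Ω → Equiv.Perm (Fin b)}

lemma sum_prod_digitGain_eq_gain (hb : 2 ≤ b) {n : ℕ} (hn : n ≠ 0) {a : Fin n → Fin s → ℝ}
    (ha : ∀ i j, a i j ∈ Set.Ico (0 : ℝ) 1) (κ : Fin s → ℕ) :
    ∑ i, ∑ i', ∏ j, digitGain (κ j) (Real.digits (a i j) b) (Real.digits (a i' j) b) =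
      n * gain b a (Finset.univ.filter fun j => κ j ≠ 0) (fun j => κ j - 1) := by
  have hn0 : (n : ℝ) ≠ 0 := by exact_mod_cast hn
  rw [gain, ← mul_assoc, mul_one_div_cancel hn0, one_mul]
  refine Finset.sum_congr rfl fun i _ => Finset.sum_congr rfl fun i' _ => ?_
  rw [Finset.prod_filter]
  refine Finset.prod_congr rfl fun j _ => ?_
  split_ifs with h
  · rw [upsilon_eq_digitGain hb (ha i j) (ha i' j), Nat.sub_add_cancel (by omega)]
  · rw [not_not.1 h, digitGain]

/-- The second moment of the estimate as a sum of variance components, weighted by gain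
coefficients. -/
lemma IsUniformPermFamily.integral_sq_eq (hb : 2 ≤ b) (hπ : IsUniformPermFamily b s P π)
    (F : (Fin s → Fin K → Fin b) → ℝ) {n : ℕ} (y : Fin n → Fin s → ℕ → Fin b) :
    ∫ ω, (1 / (n : ℝ) * ∑ i, F (scrambledString K π (y i) ω)) ^ 2 ∂P =
      ∑ κ ∈ Fintype.piFinset fun _ : Fin s => Finset.range (K + 1),
        haarForm κ F / ((b : ℝ) ^ (2 * K)) ^ s *
          ((1 / (n : ℝ)) ^ 2 * ∑ i, ∑ i', ∏ j, digitGain (κ j) (y i j) (y i' j)) := by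
  have hint : ∀ i i', Integrable (fun ω => F (scrambledString K π (y i) ω) *
      F (scrambledString K π (y i') ω)) P := fun i i' => by
    have hm : ∀ i, Measurable fun ω => F (scrambledString K π (y i) ω) := fun i =>
      (Measurable.of_discrete (f := F)).comp (hπ.measurable_scrambledString (y i))
    have hbd : ∀ z, |F z| ≤ ∑ z, |F z| := fun z =>
      Finset.single_le_sum (f := fun z => |F z|) (fun z _ => abs_nonneg _) (Finset.mem_univ z)
    refine Integrable.of_bound ((hm i).mul (hm i')).aestronglyMeasurable
      ((∑ z, |F z|) * ∑ z, |F z|) (ae_of_all _ fun ω => ?_)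
    rw [Real.norm_eq_abs, abs_mul]
    exact mul_le_mul (hbd _) (hbd _) (abs_nonneg _) ((abs_nonneg _).trans (hbd (fun _ _ => 0)))
  simp only [mul_pow, sq (∑ i, F (scrambledString K π (y i) _)), Finset.sum_mul_sum]
  rw [integral_const_mul, integral_finsetSum _ fun i _ => integrable_finsetSum _ fun i' _ =>
    hint i i']
  rw [Finset.sum_congr rfl fun i _ => integral_finsetSum _ fun i' _ => hint i i']
  simp only [hπ.integral_mul hb, Finset.mul_sum]
  rw [Finset.sum_congr rfl fun i _ => Finset.sum_comm, Finset.sum_comm]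
  refine Finset.sum_congr rfl fun κ _ => Finset.sum_congr rfl fun i _ =>
    Finset.sum_congr rfl fun i' _ => ?_
  ring

/-- Only the variance components of order more than `m - t` contribute to the second moment of
the estimate for a centred function of finitely many digits. -/
lemma IsUniformPermFamily.integral_sq_le (hb : 2 ≤ b) (hs : 1 ≤ s)
    (hπ : IsUniformPermFamily b s P π) {a : Fin (b ^ m) → Fin s → ℝ} (ha : IsNet b t m a) {G : ℝ}
    (hG : ∀ (u : Finset (Fin s)) (κ : Fin s → ℕ), u.Nonempty → gain b a u κ ≤ G)
    {F : (Fin s → Fin K → Fin b) → ℝ} (hF0 : ∑ z, F z = 0) {C ρ : ℝ} (hC : 0 ≤ C) (hρ : 0 < ρ)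
    (hρ1 : ρ ≤ 1)
    (hF : ∀ w : Finset (Fin s), w.Nonempty → ∀ (z z' : Fin s → Fin K → Fin b) (k : Fin s → ℕ),
      (∀ j, ∀ i < k j, zeroExt (z j) i = zeroExt (z' j) i) →
      |rdiff id w F z z'| ≤ C * ∏ j ∈ w, ρ ^ k j) :
    ∫ ω, (1 / ((b ^ m : ℕ) : ℝ) *
      ∑ i, F (scrambledString K π (fun j => Real.digits (a i j) b) ω)) ^ 2 ∂P ≤
      4 ^ s * C ^ 2 / (ρ ^ 2) ^ s * (|G| / ((b ^ m : ℕ) : ℝ)) *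
        ∑ κ ∈ (Fintype.piFinset fun _ : Fin s => Finset.range (K + 1)).filter
          (fun κ => m - t + 1 ≤ ∑ j, κ j), (ρ ^ 2) ^ (∑ j, κ j) := by
  have hn : b ^ m ≠ 0 := pow_ne_zero _ (NeZero.ne b)
  have hn0 : (0 : ℝ) < ((b ^ m : ℕ) : ℝ) := by exact_mod_cast Nat.pos_of_ne_zero hn
  rw [hπ.integral_sq_eq hb F fun i j => Real.digits (a i j) b, Finset.mul_sum, Finset.sum_filter]
  refine Finset.sum_le_sum fun κ hκ => ?_
  have hκK : ∀ j, κ j ≤ K := fun j => by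
    have := Fintype.mem_piFinset.1 hκ j
    rw [Finset.mem_range] at this
    omega
  by_cases hκ0 : κ = 0
  · have : haarForm κ F = 0 := by
      simp only [haarForm, hκ0, Pi.zero_apply, haarKernel, Finset.prod_const_one, mul_one]
      rw [← Finset.sum_mul_sum, hF0, zero_mul]
    rw [this, zero_div, zero_mul]
    split_ifs <;> positivity
  split_ifs with hlow
  · have h1 := haarForm_mem_Icc hκK hκ0 hC hρ hρ1 hF
    rw [sum_prod_digitGain_eq_gain hb hn (ha.mem_Ico hb hs)]
    have hu : (Finset.univ.filter fun j => κ j ≠ 0).Nonempty := by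
      obtain ⟨j, hj⟩ := Function.ne_iff.1 hκ0
      exact ⟨j, by simpa using hj⟩
    have h2 : (1 / ((b ^ m : ℕ) : ℝ)) ^ 2 * (((b ^ m : ℕ) : ℝ) *
        gain b a (Finset.univ.filter fun j => κ j ≠ 0) fun j => κ j - 1) ≤
        |G| / ((b ^ m : ℕ) : ℝ) := by
      have h3 := (hG _ (fun j => κ j - 1) hu).trans (le_abs_self G)
      rw [show (1 / ((b ^ m : ℕ) : ℝ)) ^ 2 * (((b ^ m : ℕ) : ℝ) *
        gain b a (Finset.univ.filter fun j => κ j ≠ 0) fun j => κ j - 1) =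
        gain b a (Finset.univ.filter fun j => κ j ≠ 0) (fun j => κ j - 1) / ((b ^ m : ℕ) : ℝ) by
          field_simp]
      exact div_le_div_of_nonneg_right h3 hn0.le
    calc _ ≤ haarForm κ F / ((b : ℝ) ^ (2 * K)) ^ s * (|G| / ((b ^ m : ℕ) : ℝ)) :=
          mul_le_mul_of_nonneg_left h2 h1.1
      _ ≤ 4 ^ s * C ^ 2 / (ρ ^ 2) ^ s * (ρ ^ 2) ^ (∑ j, κ j) * (|G| / ((b ^ m : ℕ) : ℝ)) :=
          mul_le_mul_of_nonneg_right h1.2 (by positivity)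
      _ = _ := by ring
  · rw [ha.sum_prod_digitGain_eq_zero hb hs (by omega) hκ0]
    simp

end moment_bound

/-! ### Tails of multiple geometric series -/

/-- There are at most `(r + 1) ^ s` multi-indices of length `s + 1` and order `r`. -/
lemma card_filter_sum_eq_le (s K r : ℕ) :
    ((Fintype.piFinset fun _ : Fin (s + 1) => Finset.range (K + 1)).filter
      fun κ => ∑ j, κ j = r).card ≤ (r + 1) ^ s := by
  have h1 : (Fintype.piFinset fun _ : Fin s => Finset.range (r + 1)).card = (r + 1) ^ s := by
    simp [Fintype.card_piFinset]
  rw [← h1]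
  -- the last `s` entries determine the first one
  refine Finset.card_le_card_of_injOn (fun κ j => κ j.succ) (fun κ hκ => ?_) fun κ hκ κ' hκ' h => ?_
  · rw [Finset.mem_coe, Finset.mem_filter] at hκ
    rw [Finset.mem_coe, Fintype.mem_piFinset]
    intro j
    have := Finset.single_le_sum (f := κ) (fun _ _ => Nat.zero_le _) (Finset.mem_univ j.succ)
    change κ j.succ ∈ _
    rw [Finset.mem_range]
    omega
  · rw [Finset.mem_coe, Finset.mem_filter, Fin.sum_univ_succ] at hκ hκ'
    have h2 : ∀ j : Fin s, κ j.succ = κ' j.succ := fun j => congrFun h j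
    have h3 := hκ.2
    simp only [h2] at h3
    have h4 := hκ'.2
    ext j
    refine Fin.cases ?_ h2 j
    omega

lemma exists_sum_pow_le {s : ℕ} (hs : 1 ≤ s) {q : ℝ} (hq0 : 0 ≤ q) (hq1 : q < 1) :
    ∃ A : ℝ, 0 ≤ A ∧ ∀ K R : ℕ,
      ∑ κ ∈ (Fintype.piFinset fun _ : Fin s => Finset.range (K + 1)).filter
        (fun κ => R ≤ ∑ j, κ j), q ^ (∑ j, κ j) ≤ A * ((R : ℝ) + 1) ^ (s - 1) * q ^ R := by
  obtain ⟨s, rfl⟩ := Nat.exists_eq_add_of_le' hs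
  have hsum : Summable fun i : ℕ => ((i : ℝ) + 1) ^ s * q ^ i := by
    rcases hq0.eq_or_lt with rfl | hq
    · refine summable_of_ne_finset_zero (s := {0}) fun i hi => ?_
      rw [zero_pow (by simpa using hi), mul_zero]
    have h1 := (summable_nat_add_iff 1).2
      (summable_pow_mul_geometric_of_norm_lt_one s (r := q) (by rwa [Real.norm_of_nonneg hq0]))
    refine (h1.mul_left q⁻¹).congr fun i => ?_
    push_cast
    rw [pow_succ]
    field_simp
  refine ⟨∑' i : ℕ, ((i : ℝ) + 1) ^ s * q ^ i, tsum_nonneg fun i => by positivity, fun K R => ?_⟩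
  set T := (s + 1) * K + 1
  have hmaps : ∀ κ ∈ (Fintype.piFinset fun _ : Fin (s + 1) => Finset.range (K + 1)).filter
      (fun κ => R ≤ ∑ j, κ j), ∑ j, κ j ∈ Finset.Ico R (R + T) := fun κ hκ => by
    rw [Finset.mem_filter, Fintype.mem_piFinset] at hκ
    have : ∑ j, κ j ≤ ∑ _j : Fin (s + 1), K := Finset.sum_le_sum fun j _ => by
      have := Finset.mem_range.1 (hκ.1 j)
      omega
    simp only [Finset.sum_const, Finset.card_univ, Fintype.card_fin, smul_eq_mul] at this
    rw [Finset.mem_Ico]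
    exact ⟨hκ.2, by omega⟩
  rw [← Finset.sum_fiberwise_of_maps_to hmaps]
  calc _ ≤ ∑ r ∈ Finset.Ico R (R + T), ((r : ℝ) + 1) ^ s * q ^ r := by
        refine Finset.sum_le_sum fun r _ => ?_
        rw [Finset.sum_congr rfl (g := fun _ => q ^ r) fun κ hκ => by
          rw [(Finset.mem_filter.1 hκ).2], Finset.sum_const, nsmul_eq_mul]
        refine mul_le_mul_of_nonneg_right ?_ (by positivity)
        have h1 := (Finset.card_le_card (Finset.filter_subset_filter
          (fun κ : Fin (s + 1) → ℕ => ∑ j, κ j = r)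
          (Finset.filter_subset (fun κ : Fin (s + 1) → ℕ => R ≤ ∑ j, κ j) _))).trans
          (card_filter_sum_eq_le s K r)
        exact_mod_cast h1
    _ = ∑ i ∈ Finset.range T, (((R + i : ℕ) : ℝ) + 1) ^ s * q ^ (R + i) := by
        rw [Finset.sum_Ico_eq_sum_range, Nat.add_sub_cancel_left]
    _ ≤ ∑ i ∈ Finset.range T, ((R : ℝ) + 1) ^ s * q ^ R * (((i : ℝ) + 1) ^ s * q ^ i) := by
        refine Finset.sum_le_sum fun i _ => ?_
        have h1 : ((R + i : ℕ) : ℝ) + 1 ≤ ((R : ℝ) + 1) * ((i : ℝ) + 1) := by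
          push_cast
          have : (0 : ℝ) ≤ (R : ℝ) * i := by positivity
          linarith
        calc _ ≤ (((R : ℝ) + 1) * ((i : ℝ) + 1)) ^ s * q ^ (R + i) :=
              mul_le_mul_of_nonneg_right (pow_le_pow_left₀ (by positivity) h1 _) (by positivity)
          _ = _ := by rw [mul_pow, pow_add]; ring
    _ ≤ _ := by
        rw [← Finset.mul_sum]
        have h2 := hsum.sum_le_tsum (Finset.range T) fun i _ => by positivity
        rw [Nat.add_sub_cancel]
        calc _ ≤ ((R : ℝ) + 1) ^ s * q ^ R * ∑' i : ℕ, ((i : ℝ) + 1) ^ s * q ^ i :=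
              mul_le_mul_of_nonneg_left h2 (by positivity)
          _ = _ := by ring

/-! ### From finitely many digits to the estimate -/

section limit

variable {b s : ℕ}

lemma rdiff_sub_const {ι κ A : Type*} [DecidableEq κ] (p : ι → κ) {w : Finset κ}
    (hw : w.Nonempty) (f : (ι → A) → ℝ) (c : ℝ) (x x' : ι → A) :
    rdiff p w (fun z => f z - c) x x' = rdiff p w f x x' := by
  simp only [rdiff, mul_sub, Finset.sum_sub_distrib, ← Finset.sum_mul]
  have := Finset.sum_powerset_neg_one_pow_card_of_nonempty hw
  rw [show ∑ v ∈ w.powerset, (-1 : ℝ) ^ v.card = 0 by exact_mod_cast this, zero_mul, sub_zero]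

/-- The bound on rectangular differences implies a modulus of continuity in the digits. -/
lemma abs_sub_le_of_rdiff_bound {Φ : (Fin s → ℕ → Fin b) → ℝ} {C ρ : ℝ}
    (hΦ : ∀ (w : Finset (Fin s)) (y y' : Fin s → ℕ → Fin b) (k : Fin s → ℕ),
      (∀ j, ∀ i < k j, y j i = y' j i) → |rdiff id w Φ y y'| ≤ C * ∏ j ∈ w, ρ ^ k j)
    {y y' : Fin s → ℕ → Fin b} {K : ℕ} (h : ∀ j, ∀ i < K, y j i = y' j i) :
    |Φ y - Φ y'| ≤ s * (C * ρ ^ K) := by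
  have key : ∀ V : Finset (Fin s), |Φ y - Φ (mix id V y y')| ≤ V.card * (C * ρ ^ K) := by
    intro V
    induction V using Finset.induction_on with
    | empty => simp [mix_empty]
    | insert j V hj ih =>
      have h1 := hΦ {j} (mix id V y y') y' (fun _ => K) fun l i hi => by
        simp only [mix]; split_ifs
        · rfl
        · exact h l i hi
      rw [← insert_empty_eq j, rdiff_insert id (Finset.notMem_empty j), rdiff_empty, rdiff_empty,
        mix_mix, insert_empty_eq, ← Finset.insert_eq, Finset.prod_singleton] at h1
      rw [Finset.card_insert_of_notMem hj]
      have h2 := abs_sub_le (Φ y) (Φ (mix id V y y')) (Φ (mix id (insert j V) y y'))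
      push_cast
      linarith
  have h3 := key Finset.univ
  rwa [Finset.card_univ, Fintype.card_fin,
    show mix id Finset.univ y y' = y' by ext1 j; simp [mix]] at h3

variable [NeZero b] {Ω : Type*} [MeasurableSpace Ω] {P : Measure Ω}
  [IsProbabilityMeasure P] {π : Fin s × List (Fin b) → Ω → Equiv.Perm (Fin b)}

/-- A bound of the second moments for centred functions of finitely many digits, uniform in their
number, passes to the variance for a function `Φ` of all digits. -/
lemma IsUniformPermFamily.variance_le (hb : 2 ≤ b) (hs : 1 ≤ s)
    (hπ : IsUniformPermFamily b s P π) {t m : ℕ} {a : Fin (b ^ m) → Fin s → ℝ}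
    (ha : IsNet b t m a) {G : ℝ}
    (hG : ∀ (u : Finset (Fin s)) (κ : Fin s → ℕ), u.Nonempty → gain b a u κ ≤ G)
    {Φ : (Fin s → ℕ → Fin b) → ℝ} {C ρ : ℝ} (hC : 0 ≤ C) (hρ : 0 < ρ) (hρ1 : ρ < 1)
    (hΦ : ∀ (w : Finset (Fin s)) (y y' : Fin s → ℕ → Fin b) (k : Fin s → ℕ),
      (∀ j, ∀ i < k j, y j i = y' j i) → |rdiff id w Φ y y'| ≤ C * ∏ j ∈ w, ρ ^ k j)
    {B : ℝ} (hB : ∀ K : ℕ, 4 ^ s * C ^ 2 / (ρ ^ 2) ^ s * (|G| / ((b ^ m : ℕ) : ℝ)) *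
        ∑ κ ∈ (Fintype.piFinset fun _ : Fin s => Finset.range (K + 1)).filter
          (fun κ => m - t + 1 ≤ ∑ j, κ j), (ρ ^ 2) ^ (∑ j, κ j) ≤ B)
    {X : Ω → ℝ} (hX : X =ᵐ[P] fun ω => 1 / ((b ^ m : ℕ) : ℝ) * ∑ i, Φ fun j =>
      scrambleDigits (fun w => π (j, w) ω) (Real.digits (a i j) b)) :
    MemLp X 2 P ∧ variance X P ≤ B := by
  have hn0 : (0 : ℝ) < ((b ^ m : ℕ) : ℝ) := by
    exact_mod_cast Nat.pos_of_ne_zero (pow_ne_zero _ (NeZero.ne b))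
  set n : ℝ := ((b ^ m : ℕ) : ℝ) with hn
  have hΦC : ∀ y, |Φ y| ≤ C := fun y => by
    simpa [rdiff_empty] using hΦ ∅ y y 0 (by simp)
  have havg : ∀ x : Fin (b ^ m) → ℝ, (∀ i, |x i| ≤ C) → |1 / n * ∑ i, x i| ≤ C := fun x hx => by
    rw [abs_mul, abs_of_pos (by positivity), one_div, inv_mul_le_iff₀ hn0]
    refine (Finset.abs_sum_le_sum_abs _ _).trans ((Finset.sum_le_sum fun i _ => hx i).trans ?_)
    simp [hn]
  set Y : Ω → ℝ := fun ω => 1 / n * ∑ i, Φ fun j =>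
    scrambleDigits (fun w => π (j, w) ω) (Real.digits (a i j) b) with hY
  set Z : ℕ → Ω → ℝ := fun K ω => 1 / n * ∑ i, Φ fun j =>
    zeroExt (scrambledString K π (fun j => Real.digits (a i j) b) ω j) with hZ
  have hZm : ∀ K, Measurable (Z K) := fun K => by
    refine (Finset.measurable_sum _ fun i _ => ?_).const_mul _
    exact (Measurable.of_discrete (f := fun z : Fin s → Fin K → Fin b => Φ fun j =>
      zeroExt (z j))).comp (hπ.measurable_scrambledString _)
  have hZC : ∀ K ω, |Z K ω| ≤ C := fun K ω => havg _ fun i => hΦC _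
  have hYC : ∀ ω, |Y ω| ≤ C := fun ω => havg _ fun i => hΦC _
  have hlim : ∀ ω, Tendsto (fun K => Z K ω) atTop (𝓝 (Y ω)) := fun ω => by
    refine (tendsto_finsetSum _ fun i _ => ?_).const_mul _
    rw [tendsto_iff_dist_tendsto_zero]
    refine squeeze_zero (fun _ => dist_nonneg) (fun K => ?_) (g := fun K => s * (C * ρ ^ K)) ?_
    · rw [Real.dist_eq]
      refine abs_sub_le_of_rdiff_bound hΦ fun j l hl => ?_
      rw [zeroExt_apply _ hl]
      rfl
    · simpa using ((tendsto_pow_atTop_nhds_zero_of_lt_one hρ.le hρ1).const_mul C).const_mul (s : ℝ)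
  have hYm : Measurable Y := measurable_of_tendsto_metrizable hZm (tendsto_pi_nhds.2 hlim)
  have hYL : MemLp Y 2 P := MemLp.of_bound hYm.aestronglyMeasurable C (ae_of_all _ hYC)
  have hZL : ∀ K, MemLp (Z K) 2 P := fun K =>
    MemLp.of_bound (hZm K).aestronglyMeasurable C (ae_of_all _ (hZC K))
  have hvarZ : ∀ K, variance (Z K) P ≤ B := fun K => by
    set F₀ : (Fin s → Fin K → Fin b) → ℝ := fun z => Φ fun j => zeroExt (z j) with hF₀
    -- centre the function at its mean over all strings
    set c : ℝ := (∑ z, F₀ z) / Fintype.card (Fin s → Fin K → Fin b) with hc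
    have hcard : (Fintype.card (Fin s → Fin K → Fin b) : ℝ) ≠ 0 := by
      exact_mod_cast Fintype.card_ne_zero
    have hrd : ∀ w : Finset (Fin s), w.Nonempty → ∀ (z z' : Fin s → Fin K → Fin b)
        (k : Fin s → ℕ), (∀ j, ∀ i < k j, zeroExt (z j) i = zeroExt (z' j) i) →
        |rdiff id w (fun z => F₀ z - c) z z'| ≤ C * ∏ j ∈ w, ρ ^ k j := fun w hw z z' k hk => by
      rw [rdiff_sub_const id hw]
      have h1 : rdiff id w F₀ z z' =
          rdiff id w Φ (fun j => zeroExt (z j)) (fun j => zeroExt (z' j)) := by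
        refine Finset.sum_congr rfl fun V _ => ?_
        simp only [hF₀]
        congr 2
        funext j
        simp only [mix]
        split_ifs <;> rfl
      rw [h1]
      exact hΦ w _ _ k hk
    have h2 := hπ.integral_sq_le hb hs ha hG (F := fun z => F₀ z - c)
      (by rw [Finset.sum_sub_distrib, Finset.sum_const, Finset.card_univ, nsmul_eq_mul, hc,
        mul_div_cancel₀ _ hcard, sub_self]) hC hρ hρ1.le hrd
    have h3 : ∀ ω, 1 / n * ∑ i, (F₀ (scrambledString K π (fun j => Real.digits (a i j) b) ω) - c) =
        Z K ω - c := fun ω => by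
      simp only [Finset.sum_sub_distrib, Finset.sum_const, Finset.card_univ, Fintype.card_fin,
        nsmul_eq_mul, mul_sub, ← hn, hZ, hF₀]
      field_simp
    simp only [← hn, h3] at h2
    have h4 := variance_sub_const (hZm K).aestronglyMeasurable c (μ := P)
    rw [← h4]
    refine (variance_le_expectation_sq (((hZm K).sub_const c).aestronglyMeasurable)).trans ?_
    exact h2.trans (hB K)
  have hvar : Tendsto (fun K => variance (Z K) P) atTop (𝓝 (variance Y P)) := by
    simp only [variance_eq_sub hYL, variance_eq_sub (hZL _)]
    refine Tendsto.sub ?_ (Tendsto.pow ?_ 2)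
    · refine tendsto_integral_of_dominated_convergence (fun _ => C ^ 2)
        (fun K => ((hZm K).pow_const 2).aestronglyMeasurable) (integrable_const _)
        (fun K => ae_of_all _ fun ω => ?_) (ae_of_all _ fun ω => (hlim ω).pow 2)
      simp only [Pi.pow_apply, norm_pow, Real.norm_eq_abs]
      exact pow_le_pow_left₀ (abs_nonneg _) (hZC K ω) 2
    · exact tendsto_integral_of_dominated_convergence (fun _ => C)
        (fun K => (hZm K).aestronglyMeasurable) (integrable_const _)
        (fun K => ae_of_all _ fun ω => hZC K ω) (ae_of_all _ hlim)
  exact ⟨hYL.ae_eq hX.symm, (variance_congr hX).trans_le (le_of_tendsto' hvar hvarZ)⟩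

/-- Almost surely the estimate is the average of the digit integrand over the scrambled digits. -/
lemma IsUniformPermFamily.muHat_ae_eq (hb : 2 ≤ b) (hπ : IsUniformPermFamily b s P π) {d n : ℕ}
    (cell : Fin s → List (Fin b) → Set (EuclideanSpace ℝ (Fin d)))
    (f : (Fin s × Fin d → ℝ) → ℝ) (a : Fin n → Fin s → ℝ) :
    muHat cell f a π =ᵐ[P] fun ω => 1 / (n : ℝ) * ∑ i, digitIntegrand cell f fun j =>
      scrambleDigits (fun w => π (j, w) ω) (Real.digits (a i j) b) := by
  have h1 : ∀ᵐ ω ∂P, ∀ i j, ∀ k₀, ∃ k ≥ k₀,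
      (scrambleDigits (fun w => π (j, w) ω) (Real.digits (a i j) b) k : ℕ) ≠ b - 1 :=
    ae_all_iff.2 fun i => ae_all_iff.2 fun j => hπ.ae_exists_ne_last hb _ j
  filter_upwards [h1] with ω hω
  simp only [muHat, digitIntegrand, splitTransform_eq_limitPoint, nestedScramble_eq_ofDigits,
    digits_ofDigits hb (hω _ _)]

end limit

end GeomNet

theorem mainTheorem1 (b s d t : ℕ) [NeZero b] (hb : 2 ≤ b) (hs : 1 ≤ s) (hd : 1 ≤ d)
    (X : Fin s → Set (EuclideanSpace ℝ (Fin d)))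
    (hX : ∀ j, Bornology.IsBounded (X j) ∧ volume (X j) = 1)
    (cell : Fin s → List (Fin b) → Set (EuclideanSpace ℝ (Fin d)))
    (hsplit : ∀ j, GeomNet.IsRecursiveSplit b (X j) (cell j))
    (hconv : ∀ j, GeomNet.IsConvergentSplit (cell j))
    (hsph : ∀ j, GeomNet.SatisfiesSphericity (cell j))
    (f : (Fin s × Fin d → ℝ) → ℝ)
    (hf : (GeomNet.IsSobolExtensible (GeomNet.prodSet X) ∧
            GeomNet.IsSmoothOn f (GeomNet.prodSet X)) ∨
          ((∀ j, IsClosed (X j) ∧ (interior (X j)).Nonempty ∧ volume (frontier (X j)) = 0) ∧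
            GeomNet.IsWhitneyC (d * s) f (GeomNet.prodSet X)))
    (G : ℝ) :
    ∃ K : ℝ, ∀ m : ℕ, 1 ≤ m → ∀ a : Fin (b ^ m) → Fin s → ℝ, GeomNet.IsNet b t m a →
      (∀ (u : Finset (Fin s)) (κ : Fin s → ℕ), u.Nonempty → GeomNet.gain b a u κ ≤ G) →
      ∀ (Ω : Type*) [MeasurableSpace Ω] (P : Measure Ω) [IsProbabilityMeasure P]
        (π : Fin s × List (Fin b) → Ω → Equiv.Perm (Fin b)),
        GeomNet.IsUniformPermFamily b s P π →
        MemLp (GeomNet.muHat cell f a π) 2 P ∧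
        variance (GeomNet.muHat cell f a π) P ≤
          K * (Real.log ((b ^ m : ℕ) : ℝ) ^ (s - 1) /
            ((b ^ m : ℕ) : ℝ) ^ (1 + 2 / (d : ℝ))) := by
  obtain ⟨C, hC, hΦ⟩ := GeomNet.exists_rdiff_digitIntegrand_bound hb hd (fun j => (hX j).1)
    hsplit hconv hsph (hf.imp id fun h => ⟨fun j => (h.1 j).1, h.2⟩)
  set ρ : ℝ := (b : ℝ) ^ (-(1 / (d : ℝ))) with hρdef
  have hb1 : (1 : ℝ) < b := by exact_mod_cast hb
  have hb0 : (0 : ℝ) < b := by linarith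
  have hd0 : (0 : ℝ) < d := by exact_mod_cast hd
  have hρ : 0 < ρ := Real.rpow_pos_of_pos hb0 _
  have hρ1 : ρ < 1 := Real.rpow_lt_one_of_one_lt_of_neg hb1 (by
    have : 0 < 1 / (d : ℝ) := by positivity
    linarith)
  have hq1 : ρ ^ 2 < 1 := pow_lt_one₀ hρ.le hρ1 two_ne_zero
  obtain ⟨A, hA0, hA⟩ := GeomNet.exists_sum_pow_le hs (sq_nonneg ρ) hq1
  have hlog : 0 < Real.log b := Real.log_pos hb1
  refine ⟨4 ^ s * C ^ 2 / (ρ ^ 2) ^ s * |G| * A * (3 / Real.log b) ^ (s - 1) / (ρ ^ 2) ^ t,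
    fun m hm a ha hG Ω _ P _ π hπ => ?_⟩
  refine hπ.variance_le hb hs ha hG hC hρ hρ1 hΦ (fun K => ?_) (hπ.muHat_ae_eq hb cell f a)
  have htm : t ≤ m := ha.1
  have hm0 : (1 : ℝ) ≤ m := by exact_mod_cast hm
  refine (mul_le_mul_of_nonneg_left (hA K (m - t + 1)) (by positivity)).trans ?_
  have h1 : (((m - t + 1 : ℕ) : ℝ) + 1) ^ (s - 1) ≤ (3 * (m : ℝ)) ^ (s - 1) := by
    refine pow_le_pow_left₀ (by positivity) ?_ _
    have : ((m - t + 1 : ℕ) : ℝ) + 1 ≤ (m : ℝ) + 2 := by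
      have : m - t + 1 + 1 ≤ m + 2 := by omega
      exact_mod_cast this
    linarith
  have h2 : (ρ ^ 2) ^ (m - t + 1) ≤ (ρ ^ 2) ^ m / (ρ ^ 2) ^ t := by
    rw [le_div_iff₀ (by positivity), ← pow_add]
    exact pow_le_pow_of_le_one (sq_nonneg ρ) hq1.le (by omega)
  have hn : ((b ^ m : ℕ) : ℝ) = (b : ℝ) ^ m := by push_cast; rfl
  have h3 : ((b ^ m : ℕ) : ℝ) ^ (1 + 2 / (d : ℝ)) = (b : ℝ) ^ m / (ρ ^ 2) ^ m := by
    have h4 : (ρ ^ 2) ^ m = (b : ℝ) ^ (-(2 / (d : ℝ) * m)) := by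
      rw [← pow_mul, hρdef, ← Real.rpow_natCast, ← Real.rpow_mul hb0.le]
      congr 1; push_cast; ring
    have h5 : ((b : ℝ) ^ m) ^ (2 / (d : ℝ)) = (b : ℝ) ^ (2 / (d : ℝ) * m) := by
      rw [← Real.rpow_natCast, ← Real.rpow_mul hb0.le, mul_comm]
    rw [hn, Real.rpow_add (by positivity), Real.rpow_one, h4, h5, Real.rpow_neg hb0.le,
      div_inv_eq_mul]
  have h6 : Real.log ((b ^ m : ℕ) : ℝ) = m * Real.log b := by rw [hn, Real.log_pow]
  rw [h3, h6]
  calc _ ≤ 4 ^ s * C ^ 2 / (ρ ^ 2) ^ s * (|G| / ((b ^ m : ℕ) : ℝ)) *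
        (A * (3 * (m : ℝ)) ^ (s - 1) * ((ρ ^ 2) ^ m / (ρ ^ 2) ^ t)) := by
        refine mul_le_mul_of_nonneg_left ?_ (by positivity)
        exact mul_le_mul (mul_le_mul_of_nonneg_left h1 hA0) h2 (by positivity) (by positivity)
    _ = _ := by
        rw [hn, mul_pow, mul_pow, div_pow]
        field_simp
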